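/- For distributions $p,q$ on $[n]$ let $d_{TV}(p,q)=\max_{S\subseteq[n]}|p(S)-q(S)|$. A sample algorithm on $[n]$ with $s$ samples is a randomized map from $[n]^s$ to $\{\mathsf{accept},\mathsf{reject},\bot\}$. It is $\xi$-differentially private if $\Pr[A(X)\in O]\le e^{\xi}\Pr[A(X')\in O]$ for all datasets $X,X'$ that differ in exactly one sample and all sets $O$ of answers. Fix a known distribution $q$ and an advice distribution $\hat p$. A $(\xi,\varepsilon,\alpha,\delta)$-private augmented identity tester is a $\xi$-differentially private sample algorithm such that, for every distribution $p$ from which the samples are drawn i.i.d.: if $p=q$ it outputs $\mathsf{reject}$ with probability at most $\delta$; if $d_{TV}(p,q)>\varepsilon$ it outputs $\mathsf{accept}$ with probability at most $\delta$; if $d_{TV}(p,\hat p)\le\alpha$ it outputs $\bot$ with probability at most $\delta$. A $(\xi,\varepsilon,\delta)$-private identity tester is a $\xi$-differentially private sample algorithm with answers in $\{\mathsf{accept},\mathsf{reject}\}$ that satisfies the first two of these three requirements. Put $\eta=d_{TV}(\hat p,q)$ and $$f=\frac{\sqrt n}{\varepsilon^2}+\frac{\sqrt n}{\varepsilon\sqrt\xi}+\frac{n^{1/3}}{\varepsilon^{4/3}\xi^{2/3}}+\frac1{\varepsilon\xi},\qquad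 g=\frac1{(\eta-\alpha)^2}+\frac1{(\eta-\alpha)\xi}.$$ Given a constant $K>0$ and, for each $n,q,\varepsilon,\xi$, a sample algorithm $B_{n,q,\varepsilon,\xi}$, consider two algorithms. Noisy Scheffé test (for $\eta>\alpha$): with $S=\{i:\hat p_i<q_i\}$, draw $s=\lceil K g\rceil$ samples $x_1,\dots,x_s$, compute $\sigma=\frac1s\sum_{j=1}^s \mathbf 1[x_j\in S]$ and $\hat\sigma=\sigma+\mathrm{Lap}(1/(s\xi))$, where $\mathrm{Lap}(b)$ is centred Laplace noise of scale $b$; output $\mathsf{reject}$ if $|\hat\sigma-q(S)|>(\eta-\alpha)/4$ and $\bot$ otherwise. Algorithm 1: if $\eta\le\alpha$ or $f\le g$, run $B_{n,q,\varepsilon,\xi}$ and output its answer; otherwise run the noisy Scheffé test. Theorem. There are absolute constants $K,c,C>0$ and sample algorithms $B_{n,q,\varepsilon,\xi}$ such that the following holds. (a) For all $n$, all distributions $q$ on $[n]$, all $\varepsilon\in(0,1]$ and $\xi>0$, $B_{n,q,\varepsilon,\xi}$ is a $(\xi,\varepsilon,1/10)$-private identity tester for $q$, and its number of samples $s$ satisfies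 $cf\le s\le Cf$. (b) For all $n$, all distributions $q,\hat p$ on $[n]$, all $\varepsilon\in(0,1]$, $\alpha\in[0,1)$ and $\xi>0$, Algorithm 1 is a $(\xi,\varepsilon,\alpha,1/10)$-private augmented identity tester, and its number of samples $s$ satisfies $cf\le s\le Cf$ if $\eta\le\alpha$, and $c\min(g,f)\le s\le C\min(g,f)$ if $\eta>\alpha$. (c) If moreover $\eta>\alpha$, the noisy Scheffé test by itself is a $(\xi,\varepsilon,\alpha,1/10)$-private augmented identity tester, and its number of samples $s$ satisfies $cg\le s\le Cg$. -/

import Mathlib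

open MeasureTheory

namespace PrivTest

noncomputable section

/-- The possible answers of a tester. -/
inductive Answer where
  | accept
  | reject
  | bot

instance : MeasurableSpace Answer := ⊤

/-- The probability `p(S)` of an event `S` under a distribution `p` over an `n`-point domain. -/
def mass {n : ℕ} (p : PMF (Fin n)) (S : Finset (Fin n)) : ℝ :=
  ∑ i ∈ S, (p i).toReal

/-- Total variation distance: the maximum over all events `S` of `|p(S) - q(S)|`. -/
def tv {n : ℕ} (p q : PMF (Fin n)) : ℝ :=
  ⨆ S : Finset (Fin n), |mass p S - mass q S|

/-- A randomized algorithm that reads `numSamples` samples from the domain; on the dataset `x`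
its random answer has law `run x`. That the laws are probability measures is `IsRandomized`. -/
structure SampleAlgorithm (n : ℕ) where
  /-- the number of samples read -/
  numSamples : ℕ
  /-- the law of the answer on a given dataset -/
  run : (Fin numSamples → Fin n) → Measure Answer

namespace SampleAlgorithm

variable {n : ℕ}

/-- On every dataset the answer is a genuine random variable. -/
def IsRandomized (A : SampleAlgorithm n) : Prop :=
  ∀ x, IsProbabilityMeasure (A.run x)

/-- The probability that the answer of `A` lies in `O` when its samples are drawn i.i.d.
from `p`, over the samples and the internal randomness of `A`. -/
def prob (A : SampleAlgorithm n) (p : PMF (Fin n)) (O : Set Answer) : ENNReal :=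
  ∫⁻ x, A.run x O ∂(Measure.pi fun _ : Fin A.numSamples => p.toMeasure)

/-- Pure `ξ`-differential privacy. -/
def IsDP (A : SampleAlgorithm n) (ξ : ℝ) : Prop :=
  ∀ x x' : Fin A.numSamples → Fin n, hammingDist x x' = 1 →
    ∀ O : Set Answer, A.run x O ≤ ENNReal.ofReal (Real.exp ξ) * A.run x' O

/-- `p` is `ε`-far from the property `P`. -/
def _root_.PrivTest.IsFar (ε : ℝ) (p : PMF (Fin n)) (P : Set (PMF (Fin n))) : Prop :=
  ∀ q ∈ P, ε < tv p q

/-- `A` is a `(ξ, ε, δ)`-private tester for the property `P` (without advice);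
its only answers are `accept` and `reject`. -/
structure IsPrivateTester (A : SampleAlgorithm n) (ξ ε δ : ℝ) (P : Set (PMF (Fin n))) :
    Prop where
  randomized : A.IsRandomized
  dp : A.IsDP ξ
  not_bot : ∀ x, A.run x {Answer.bot} = 0
  sound_mem : ∀ p ∈ P, A.prob p {Answer.reject} ≤ ENNReal.ofReal δ
  sound_far : ∀ p, IsFar ε p P → A.prob p {Answer.accept} ≤ ENNReal.ofReal δ

/-- `A` is a `(ξ, ε, α, δ)`-private augmented tester for the property `P` with advice `phat`. -/
structure IsPrivateAugmentedTester (A : SampleAlgorithm n) (ξ ε α δ : ℝ) (phat : PMF (Fin n))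
    (P : Set (PMF (Fin n))) : Prop where
  randomized : A.IsRandomized
  dp : A.IsDP ξ
  sound_mem : ∀ p ∈ P, A.prob p {Answer.reject} ≤ ENNReal.ofReal δ
  sound_far : ∀ p, IsFar ε p P → A.prob p {Answer.accept} ≤ ENNReal.ofReal δ
  sound_advice : ∀ p, tv p phat ≤ α → A.prob p {Answer.bot} ≤ ENNReal.ofReal δ

end SampleAlgorithm

/-- The Laplace distribution `Lap(b)`, centred at `0` with scale `b > 0`. -/
def laplace (b : ℝ) : Measure ℝ :=
  (volume : Measure ℝ).withDensity
    fun z => ENNReal.ofReal (1 / (2 * b) * Real.exp (-|z| / b))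

/-- `√n/ε² + √n/(ε√ξ) + n^{1/3}/(ε^{4/3} ξ^{2/3}) + 1/(εξ)`. -/
def identityRate (n : ℕ) (ε ξ : ℝ) : ℝ :=
  Real.sqrt n / ε ^ 2 + Real.sqrt n / (ε * Real.sqrt ξ)
    + (n : ℝ) ^ (1 / 3 : ℝ) / (ε ^ (4 / 3 : ℝ) * ξ ^ (2 / 3 : ℝ)) + 1 / (ε * ξ)

/-- `1/γ² + 1/(γξ)`, used at the gap `γ = η - α`. -/
def scheffeRate (γ ξ : ℝ) : ℝ :=
  1 / γ ^ 2 + 1 / (γ * ξ)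

/-- The Scheffé set `{i : phat_i < q_i}`. -/
def scheffeSet {n : ℕ} (phat q : PMF (Fin n)) : Finset (Fin n) :=
  {i | (phat i).toReal < (q i).toReal}

/-- The fraction of the samples `x` that lie in `S`. -/
def sampleFraction {n s : ℕ} (S : Finset (Fin n)) (x : Fin s → Fin n) : ℝ :=
  1 / (s : ℝ) * ∑ j, if x j ∈ S then 1 else 0

/-- The noisy Scheffé test, with `γ = η - α`: draw `s = ⌈K (1/γ² + 1/(γξ))⌉` samples, compute the
fraction `σ` of samples in the Scheffé set `S`, add noise `z ∼ Lap(1/(sξ))`, and answer `reject`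
if `|σ + z - q(S)| > γ/4` and `bot` otherwise. -/
def scheffeTester (K : ℝ) {n : ℕ} (q phat : PMF (Fin n)) (α ξ : ℝ) : SampleAlgorithm n where
  numSamples := ⌈K * scheffeRate (tv phat q - α) ξ⌉₊
  run := fun x =>
    (laplace (1 / ((⌈K * scheffeRate (tv phat q - α) ξ⌉₊ : ℝ) * ξ))).map fun z =>
      if |sampleFraction (scheffeSet phat q) x + z - mass q (scheffeSet phat q)|
          > (tv phat q - α) / 4
      then Answer.reject else Answer.bot

/-- The private augmented identity tester. Its subroutine `base n q ε ξ` is a private identity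
tester without advice; `K` is the constant in the sample size of the noisy Scheffé test. -/
def augmentedIdentityTester (base : (n : ℕ) → PMF (Fin n) → ℝ → ℝ → SampleAlgorithm n) (K : ℝ)
    {n : ℕ} (q phat : PMF (Fin n)) (ε α ξ : ℝ) : SampleAlgorithm n :=
  if tv phat q ≤ α ∨ identityRate n ε ξ ≤ scheffeRate (tv phat q - α) ξ
  then base n q ε ξ
  else scheffeTester K q phat α ξ

/-- `s = Θ(r)` with the constants `c` and `C`. -/
def IsThetaWith (c C : ℝ) (s : ℕ) (r : ℝ) : Prop :=
  c * r ≤ (s : ℝ) ∧ (s : ℝ) ≤ C * r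

end

end PrivTest

namespace PrivTest

/-! Algorithm 1 runs whichever admissible tester has the smaller rate, so the content lies in two
testers. Both answer through a function of a noisy additive statistic `∑ φ i (N i)` of the sample
counts `N` (`noisyAdditive`). Replacing one sample moves the statistic by at most the spread of the
increments of the `φ i`, so Laplace noise makes it private (`isDP_noisyAdditive`). The Efron-Stein
bound `variance_additive_le` with Chebyshev, and the Laplace tail, each cost error `1/20`
(`prob_noisyAdditive_le`).

Scheffé test: the statistic is the fraction of samples in `S`. Since `S` attains `η`, a `p` within
`α` of the advice has `|p(S) - q(S)| ≥ η - α`. Variance at most `1/s` and noise of scale `1/(sξ)`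
are then small enough for `s` of order `g`.

Identity tester: a `χ²` statistic has unbounded sensitivity, so each `φ i` is a Huber potential.
Before centring, its slope is `(k - s q_i)/w_i` with `w_i = s q_i + s/n`, clipped at `±D`.
Subtracting the mean slope under `q` puts the minimum of the expectation at `p = q`. Write `d_i = s
|p_i - q_i|` and `Γ = ∑ d_i min(d_i/w_i, D)`. The expectation exceeds its value at `q` by at least
`Γ/80` (`sum_binExp_huberSummand_ge`), the variance is at most `3n + 7(1+D)Γ`
(`mul_sum_binExp_huberSummand_sq_le`), and distance above `ε` forces `Γ ≥ G = sε min(ε/2, D)`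
(`statisticGap_le_discrepancy`). The test works once `√n`, `1 + D` and `D/ξ` are small against `G`.
With `D = 10 max(n/s, √(n/s))`, the four terms of `f` ensure this (`statisticGap_bounds`). -/

/-- The expectation of `φ` under the binomial distribution with parameters `s` and `x`. -/
def binExp (x : ℝ) : ℕ → (ℕ → ℝ) → ℝ
  | 0, φ => φ 0
  | s + 1, φ => (1 - x) * binExp x s φ + x * binExp x s fun k => φ (k + 1)

/-! ### Binomial expectations as functions of the success probability. -/

section binExp

variable {x : ℝ}

theorem binExp_add (s : ℕ) (φ ψ : ℕ → ℝ) :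
    binExp x s (fun k => φ k + ψ k) = binExp x s φ + binExp x s ψ := by
  induction s generalizing φ ψ with
  | zero => rfl
  | succ s ih => simp only [binExp, ih]; ring

theorem binExp_const_mul (s : ℕ) (a : ℝ) (φ : ℕ → ℝ) :
    binExp x s (fun k => a * φ k) = a * binExp x s φ := by
  induction s generalizing φ with
  | zero => rfl
  | succ s ih => simp only [binExp, ih]; ring

theorem binExp_const (s : ℕ) (a : ℝ) : binExp x s (fun _ => a) = a := by
  induction s with
  | zero => rfl
  | succ s ih => simp only [binExp, ih]; ring

theorem binExp_sub (s : ℕ) (φ ψ : ℕ → ℝ) :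
    binExp x s (fun k => φ k - ψ k) = binExp x s φ - binExp x s ψ := by
  induction s generalizing φ ψ with
  | zero => rfl
  | succ s ih => simp only [binExp, ih]; ring

theorem binExp_mono (hx0 : 0 ≤ x) (hx1 : x ≤ 1) (s : ℕ) {φ ψ : ℕ → ℝ} (h : ∀ k, φ k ≤ ψ k) :
    binExp x s φ ≤ binExp x s ψ := by
  induction s generalizing φ ψ with
  | zero => exact h 0
  | succ s ih =>
    exact add_le_add (mul_le_mul_of_nonneg_left (ih h) (by linarith))
      (mul_le_mul_of_nonneg_left (ih fun k => h (k + 1)) hx0)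

/-- The second moment around an arbitrary centre. -/
theorem binExp_sq_sub_const (s : ℕ) (φ : ℕ → ℝ) (a : ℝ) :
    binExp x s (fun k => (φ k - a) ^ 2) =
      binExp x s (fun k => (φ k - binExp x s φ) ^ 2) + (binExp x s φ - a) ^ 2 := by
  have key : ∀ a : ℝ, binExp x s (fun k => (φ k - a) ^ 2) =
      binExp x s (fun k => φ k ^ 2) - 2 * a * binExp x s φ + a ^ 2 := by
    intro a
    have : (fun k => (φ k - a) ^ 2) = fun k => (φ k ^ 2 - 2 * a * φ k) + a ^ 2 := by
      funext k; ring
    rw [this, binExp_add, binExp_sub, binExp_const_mul, binExp_const]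
  rw [key, key (binExp x s φ)]
  ring

theorem sq_binExp_le (hx0 : 0 ≤ x) (hx1 : x ≤ 1) (s : ℕ) (φ : ℕ → ℝ) :
    binExp x s φ ^ 2 ≤ binExp x s fun k => φ k ^ 2 := by
  have h := binExp_sq_sub_const (x := x) s φ 0
  simp only [sub_zero] at h
  have h2 := binExp_mono hx0 hx1 s (φ := fun _ => 0) (ψ := fun k => (φ k - binExp x s φ) ^ 2)
    fun k => sq_nonneg _
  rw [binExp_const] at h2
  linarith

theorem binExp_natCast_add (s : ℕ) (a : ℝ) : binExp x s (fun k => (k : ℝ) + a) = s * x + a := by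
  induction s generalizing a with
  | zero => simp [binExp]
  | succ s ih =>
    have : (fun k : ℕ => ((k + 1 : ℕ) : ℝ) + a) = fun k : ℕ => (k : ℝ) + (1 + a) := by
      funext k; push_cast; ring
    simp only [binExp, ih, this]; push_cast; ring

theorem binExp_natCast (s : ℕ) : binExp x s (fun k => (k : ℝ)) = s * x := by
  simpa using binExp_natCast_add (x := x) s 0

theorem binExp_natCast_sub_sq (s : ℕ) (a : ℝ) :
    binExp x s (fun k => ((k : ℝ) - a) ^ 2) = s * x * (1 - x) + (s * x - a) ^ 2 := by
  induction s generalizing a with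
  | zero => simp [binExp]
  | succ s ih =>
    have : (fun k : ℕ => (((k + 1 : ℕ) : ℝ) - a) ^ 2) = fun k : ℕ => ((k : ℝ) - (a - 1)) ^ 2 := by
      funext k; push_cast; ring
    simp only [binExp, ih, this]; push_cast; ring

/-- Mean shifts are controlled through this formula: an increment of `φ` plays the role of a
derivative, with one trial fewer. At `s = 0` the truncated `s - 1` is harmless because of the factor
`s`. -/
theorem hasDerivAt_binExp (s : ℕ) (φ : ℕ → ℝ) (x : ℝ) :
    HasDerivAt (fun y => binExp y s φ) (s * binExp x (s - 1) fun k => φ (k + 1) - φ k) x := by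
  induction s generalizing φ with
  | zero => simpa [binExp] using hasDerivAt_const x (φ 0)
  | succ s ih =>
    have h := ((((hasDerivAt_id x).const_sub 1).mul (ih φ)).add
      ((hasDerivAt_id x).mul (ih fun k => φ (k + 1))))
    refine h.congr_deriv ?_
    rcases s with _ | s
    · simp [binExp]; ring
    · simp only [id, Nat.add_sub_cancel, binExp, binExp_sub]
      push_cast; ring

end binExp

/-! ### Multinomial counts and the variance of additive statistics. -/

section countExp

variable {ι : Type*} [Fintype ι] [DecidableEq ι] {p : ι → ℝ}

/-- The expectation of `F` at the vector of counts of `s` independent samples from `p`. -/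
def countExp (p : ι → ℝ) : ℕ → ((ι → ℕ) → ℝ) → ℝ
  | 0, F => F 0
  | s + 1, F => ∑ i, p i * countExp p s fun c => F (c + Pi.single i 1)

theorem countExp_add (s : ℕ) (F G : (ι → ℕ) → ℝ) :
    countExp p s (fun c => F c + G c) = countExp p s F + countExp p s G := by
  induction s generalizing F G with
  | zero => rfl
  | succ s ih => simp only [countExp, ih, mul_add, Finset.sum_add_distrib]

theorem countExp_const_mul (s : ℕ) (a : ℝ) (F : (ι → ℕ) → ℝ) :
    countExp p s (fun c => a * F c) = a * countExp p s F := by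
  induction s generalizing F with
  | zero => rfl
  | succ s ih =>
    simp only [countExp, ih, Finset.mul_sum]
    exact Finset.sum_congr rfl fun i _ => by ring

theorem countExp_const (hp1 : ∑ i, p i = 1) (s : ℕ) (a : ℝ) : countExp p s (fun _ => a) = a := by
  induction s with
  | zero => rfl
  | succ s ih => simp only [countExp, ih, ← Finset.sum_mul, hp1, one_mul]

theorem countExp_finset_sum {κ : Type*} (s : ℕ) (t : Finset κ) (F : κ → (ι → ℕ) → ℝ) :
    countExp p s (fun c => ∑ k ∈ t, F k c) = ∑ k ∈ t, countExp p s (F k) := by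
  induction s generalizing F with
  | zero => rfl
  | succ s ih =>
    simp only [countExp]
    rw [Finset.sum_comm]
    refine Finset.sum_congr rfl fun i _ => ?_
    exact (congrArg _ (ih fun k c => F k (c + Pi.single i 1))).trans (Finset.mul_sum ..)

theorem countExp_sq_sub_const (hp1 : ∑ i, p i = 1) (s : ℕ) (F : (ι → ℕ) → ℝ) (a : ℝ) :
    countExp p s (fun c => (F c - a) ^ 2) =
      countExp p s (fun c => (F c - countExp p s F) ^ 2) + (countExp p s F - a) ^ 2 := by
  have key : ∀ a : ℝ, countExp p s (fun c => (F c - a) ^ 2) =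
      countExp p s (fun c => F c ^ 2) - 2 * a * countExp p s F + a ^ 2 := by
    intro a
    have : (fun c => (F c - a) ^ 2) = fun c => (F c ^ 2 + (-2 * a) * F c) + a ^ 2 := by
      funext k; ring
    rw [this, countExp_add, countExp_add, countExp_const_mul, countExp_const hp1]
    ring
  rw [key, key (countExp p s F)]
  ring

/-- Each count is binomial. -/
theorem countExp_apply (hp1 : ∑ i, p i = 1) (s : ℕ) (i : ι) (φ : ℕ → ℝ) :
    countExp p s (fun c => φ (c i)) = binExp (p i) s φ := by
  induction s generalizing φ with
  | zero => rfl
  | succ s ih =>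
    simp only [countExp, binExp]
    rw [← Finset.add_sum_erase _ _ (Finset.mem_univ i)]
    have h1 : ∀ j ∈ Finset.univ.erase i,
        p j * countExp p s (fun c => φ ((c + Pi.single j 1 : ι → ℕ) i)) = p j * binExp (p i) s φ := by
      intro j hj
      have : (fun c : ι → ℕ => φ ((c + Pi.single j 1 : ι → ℕ) i)) = fun c => φ (c i) := by
        funext c
        simp [(Finset.ne_of_mem_erase hj).symm]
      rw [this, ih]
    have h2 : (fun c : ι → ℕ => φ ((c + Pi.single i 1 : ι → ℕ) i)) = fun c => φ (c i + 1) := by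
      funext c; simp
    rw [Finset.sum_congr rfl h1, h2, ih fun k => φ (k + 1), ← Finset.sum_mul,
      show ∑ j ∈ Finset.univ.erase i, p j = 1 - p i by
        rw [← hp1, ← Finset.add_sum_erase _ _ (Finset.mem_univ i)]; ring]
    ring

/-- The additive statistic of the counts with the summands `φ`. -/
def additive (φ : ι → ℕ → ℝ) (c : ι → ℕ) : ℝ := ∑ i, φ i (c i)

theorem additive_add_single (φ : ι → ℕ → ℝ) (c : ι → ℕ) (i : ι) :
    additive φ (c + Pi.single i 1) = additive φ c + (φ i (c i + 1) - φ i (c i)) := by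
  unfold additive
  rw [← Finset.add_sum_erase _ _ (Finset.mem_univ i),
    ← Finset.add_sum_erase _ (fun j => φ j (c j)) (Finset.mem_univ i)]
  have : ∑ j ∈ Finset.univ.erase i, φ j ((c + Pi.single i 1 : ι → ℕ) j) =
      ∑ j ∈ Finset.univ.erase i, φ j (c j) :=
    Finset.sum_congr rfl fun j hj => by simp [Finset.ne_of_mem_erase hj]
  rw [this]
  simp only [Pi.add_apply, Pi.single_eq_same]
  ring

theorem countExp_additive (hp1 : ∑ i, p i = 1) (s : ℕ) (φ : ι → ℕ → ℝ) :
    countExp p s (additive φ) = ∑ i, binExp (p i) s (φ i) := by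
  unfold additive
  rw [countExp_finset_sum s Finset.univ fun i c => φ i (c i)]
  exact Finset.sum_congr rfl fun i _ => countExp_apply hp1 s i _

/-- An Efron-Stein inequality for additive statistics of the counts. -/
theorem variance_additive_le (hp0 : ∀ i, 0 ≤ p i) (hp1 : ∑ i, p i = 1) (s : ℕ)
    (φ : ι → ℕ → ℝ) :
    countExp p s (fun c => (additive φ c - countExp p s (additive φ)) ^ 2) ≤
      s * ∑ i, p i * binExp (p i) (s - 1) fun k => (φ i (k + 1) - φ i k) ^ 2 := by
  have hple : ∀ i, p i ≤ 1 := fun i =>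
    hp1 ▸ Finset.single_le_sum (fun j _ => hp0 j) (Finset.mem_univ i)
  induction s generalizing φ with
  | zero => simp [countExp]
  | succ s ih =>
    set a := countExp p s (additive φ) with ha
    -- The variance is the least second moment, so the mean for `s` samples may serve as centre.
    -- Conditioning on one sample `i` then leaves an additive statistic of `s` samples, whose mean
    -- differs from `a` by a mean increment of `φ i`.
    have h1 : countExp p (s + 1)
          (fun c => (additive φ c - countExp p (s + 1) (additive φ)) ^ 2) ≤
        countExp p (s + 1) (fun c => (additive φ c - a) ^ 2) := by
      rw [countExp_sq_sub_const hp1 (s + 1) (additive φ) a]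
      linarith [sq_nonneg (countExp p (s + 1) (additive φ) - a)]
    refine h1.trans ?_
    simp only [countExp, Nat.add_sub_cancel]
    -- the summands after one sample `i` has been seen
    let φ' : ι → ι → ℕ → ℝ := fun i j k => if j = i then φ j (k + 1) else φ j k
    have hφ' : ∀ i c, additive φ (c + Pi.single i 1) = additive (φ' i) c := by
      intro i c
      refine Finset.sum_congr rfl fun j _ => ?_
      by_cases h : j = i
      · subst h; simp [φ']
      · simp [φ', h]
    have hmean : ∀ i, countExp p s (additive (φ' i)) - a =
        binExp (p i) s (fun k => φ i (k + 1) - φ i k) := by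
      intro i
      have : additive (φ' i) = fun c => additive φ c + (φ i (c i + 1) - φ i (c i)) := by
        funext c; rw [← hφ', additive_add_single]
      rw [this, countExp_add, countExp_apply hp1 s i fun k => φ i (k + 1) - φ i k]
      ring
    have hi : ∀ i, countExp p s (fun c => (additive φ (c + Pi.single i 1) - a) ^ 2) ≤
        s * (∑ j, p j * binExp (p j) (s - 1) fun k => (φ' i j (k + 1) - φ' i j k) ^ 2) +
          binExp (p i) s (fun k => (φ i (k + 1) - φ i k) ^ 2) := by
      intro i
      simp only [hφ']
      rw [countExp_sq_sub_const hp1, hmean]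
      exact add_le_add (ih _) (sq_binExp_le (hp0 i) (hple i) s _)
    refine (Finset.sum_le_sum fun i _ => mul_le_mul_of_nonneg_left (hi i) (hp0 i)).trans ?_
    simp only [mul_add, Finset.sum_add_distrib]
    push_cast
    rw [add_mul, one_mul]
    refine add_le_add (le_of_eq ?_) le_rfl
    rcases s with _ | s
    · simp
    have hswap : ∀ i, p i * (((s + 1 : ℕ) : ℝ) * ∑ j, p j * binExp (p j) (s + 1 - 1)
          fun k => (φ' i j (k + 1) - φ' i j k) ^ 2) = ((s + 1 : ℕ) : ℝ) * ∑ j, p j *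
          (p i * binExp (p j) s fun k => (φ' i j (k + 1) - φ' i j k) ^ 2) := by
      intro i
      rw [mul_left_comm, Finset.mul_sum]
      congr 1
      exact Finset.sum_congr rfl fun j _ => by rw [Nat.add_sub_cancel]; ring
    rw [Finset.sum_congr rfl fun i _ => hswap i, ← Finset.mul_sum, Finset.sum_comm]
    congr 1
    refine Finset.sum_congr rfl fun j _ => ?_
    rw [← Finset.mul_sum]
    congr 1
    have := countExp_apply hp1 (s + 1) j fun k => (φ j (k + 1) - φ j k) ^ 2
    rw [← this]
    simp only [countExp]
    refine Finset.sum_congr rfl fun i _ => ?_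
    congr 1
    rw [← countExp_apply hp1 s j]
    congr 1
    funext c
    by_cases h : j = i
    · subst h; simp [φ']
    · simp [φ', h]

end countExp

/-! ### From i.i.d. datasets to counts; sensitivity to one sample. -/

section counts

variable {n : ℕ}

/-- The vector of counts of a dataset. -/
def counts {s : ℕ} (x : Fin s → Fin n) : Fin n → ℕ := ∑ j, Pi.single (x j) 1

theorem sum_prod_mul_counts (p : Fin n → ℝ) (s : ℕ) (F : (Fin n → ℕ) → ℝ) :
    ∑ x : Fin s → Fin n, (∏ j, p (x j)) * F (counts x) = countExp p s F := by
  induction s generalizing F with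
  | zero => simp [countExp, counts]
  | succ s ih =>
    rw [← (Fin.consEquiv fun _ => Fin n).sum_comp, Fintype.sum_prod_type]
    simp only [countExp, ← ih, Finset.mul_sum]
    refine Finset.sum_congr rfl fun i _ => Finset.sum_congr rfl fun x _ => ?_
    simp only [Fin.consEquiv, Equiv.coe_fn_mk, counts, Fin.prod_univ_succ, Fin.sum_univ_succ,
      Fin.cons_zero, Fin.cons_succ]
    rw [add_comm (Pi.single i 1), mul_assoc]

theorem sum_toReal_eq_one (p : PMF (Fin n)) : ∑ i, (p i).toReal = 1 := by
  rw [← ENNReal.toReal_sum fun i _ => p.apply_ne_top i]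
  have := p.tsum_coe
  rw [tsum_fintype] at this
  simp [this]

theorem integral_counts (p : PMF (Fin n)) (s : ℕ) (F : (Fin n → ℕ) → ℝ) :
    ∫ x, F (counts x) ∂(Measure.pi fun _ : Fin s => p.toMeasure) =
      countExp (fun i => (p i).toReal) s F := by
  rw [integral_fintype Integrable.of_finite, ← sum_prod_mul_counts]
  refine Finset.sum_congr rfl fun x _ => ?_
  rw [measureReal_def, Measure.pi_singleton, ENNReal.toReal_prod, smul_eq_mul]
  congr 1
  exact Finset.prod_congr rfl fun j _ => by
    rw [PMF.toMeasure_apply_singleton _ _ (measurableSet_singleton _)]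

/-- Chebyshev's inequality for statistics of the counts. -/
theorem measure_le_abs_counts_sub (p : PMF (Fin n)) (s : ℕ) (F : (Fin n → ℕ) → ℝ) (m : ℝ) {a : ℝ}
    (ha : 0 < a) :
    (Measure.pi fun _ : Fin s => p.toMeasure) {x | a ≤ |F (counts x) - m|} ≤
      ENNReal.ofReal (countExp (fun i => (p i).toReal) s (fun c => (F c - m) ^ 2) / a ^ 2) := by
  have h := meas_ge_le_lintegral_div (μ := Measure.pi fun _ : Fin s => p.toMeasure)
    (f := fun x => ENNReal.ofReal ((F (counts x) - m) ^ 2))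
    (Measurable.of_discrete).aemeasurable (ε := ENNReal.ofReal (a ^ 2)) (by simpa using ha.ne')
    ENNReal.ofReal_ne_top
  rw [← ofReal_integral_eq_lintegral_ofReal Integrable.of_finite (ae_of_all _ fun x => sq_nonneg _),
    integral_counts p s fun c => (F c - m) ^ 2, ← ENNReal.ofReal_div_of_pos (by positivity)] at h
  refine (measure_mono fun x hx => ?_).trans h
  refine ENNReal.ofReal_le_ofReal ?_
  rw [← sq_abs (F (counts x) - m)]
  exact pow_le_pow_left₀ ha.le hx 2

/-- Both datasets arise from the same counts `c` of the remaining samples by adding one increment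
each. Bounding increments by an interval rather than in absolute value gives sensitivity `1/s`, not
`2/s`, for the sample fraction. -/
theorem abs_additive_counts_sub_le {s : ℕ} {φ : Fin n → ℕ → ℝ} {a b : ℝ}
    (hφ : ∀ i k, a ≤ φ i (k + 1) - φ i k ∧ φ i (k + 1) - φ i k ≤ b)
    {x y : Fin s → Fin n} (h : hammingDist x y = 1) :
    |additive φ (counts x) - additive φ (counts y)| ≤ b - a := by
  obtain ⟨j, hj⟩ := Finset.card_eq_one.mp h
  have hne : ∀ k ∈ Finset.univ.erase j, x k = y k := by
    intro k hk
    by_contra hxy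
    have : k ∈ ({j} : Finset (Fin s)) := hj ▸ Finset.mem_filter.mpr ⟨Finset.mem_univ _, hxy⟩
    exact Finset.ne_of_mem_erase hk (Finset.mem_singleton.mp this)
  unfold counts
  rw [← Finset.sum_erase_add _ _ (Finset.mem_univ j),
    ← Finset.sum_erase_add _ (fun k => (Pi.single (y k) 1 : Fin n → ℕ)) (Finset.mem_univ j),
    Finset.sum_congr rfl fun k hk => by rw [hne k hk], additive_add_single, additive_add_single]
  set c : Fin n → ℕ := ∑ k ∈ Finset.univ.erase j, Pi.single (y k) 1
  rw [abs_le]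
  constructor <;> linarith [hφ (x j) (c (x j)), hφ (y j) (c (y j))]

end counts

/-! ### Laplace noise: total mass, tails and shifts. -/

section laplace

theorem isProbabilityMeasure_laplace {b : ℝ} (hb : 0 < b) : IsProbabilityMeasure (laplace b) := by
  constructor
  have hint : ∫ z : ℝ, 1 / (2 * b) * Real.exp (-|z| / b) = 1 := by
    rw [integral_const_mul, integral_comp_abs (f := fun z => Real.exp (-z / b))]
    have : (fun z : ℝ => Real.exp (-z / b)) = fun z => Real.exp (-(1 / b) * z) := by
      funext z; congr 1; ring
    rw [this, integral_exp_mul_Ioi (by simpa using hb)]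
    simp
    field_simp
  -- A nonintegrable function has Bochner integral `0`, so the value `1` proves integrability.
  have hI : Integrable fun z : ℝ => 1 / (2 * b) * Real.exp (-|z| / b) :=
    not_imp_comm.mp integral_undef (by rw [hint]; exact one_ne_zero)
  rw [laplace, withDensity_apply _ MeasurableSet.univ, Measure.restrict_univ,
    ← ofReal_integral_eq_lintegral_ofReal hI (ae_of_all _ fun z => by positivity), hint,
    ENNReal.ofReal_one]

/-- On the tail the density is at most `2 exp(-t/(2b))` times that of `Lap(2b)`, which has total
mass `1`. The lost factor in the exponent avoids integrating over the tail. -/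
theorem laplace_tail_le {b t : ℝ} (hb : 0 < b) :
    laplace b {z | t ≤ |z|} ≤ ENNReal.ofReal (2 * Real.exp (-t / (2 * b))) := by
  have hms : MeasurableSet {z : ℝ | t ≤ |z|} :=
    measurableSet_le measurable_const continuous_abs.measurable
  have := isProbabilityMeasure_laplace (b := 2 * b) (by positivity)
  calc laplace b {z | t ≤ |z|}
      ≤ ∫⁻ z in {z | t ≤ |z|}, ENNReal.ofReal (2 * Real.exp (-t / (2 * b))) *
          ENNReal.ofReal (1 / (2 * (2 * b)) * Real.exp (-|z| / (2 * b))) := by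
        rw [laplace, withDensity_apply _ hms]
        refine setLIntegral_mono' hms fun z hz => ?_
        rw [← ENNReal.ofReal_mul (by positivity)]
        refine ENNReal.ofReal_le_ofReal ?_
        have h1 : Real.exp (-|z| / b) ≤
            Real.exp (-t / (2 * b)) * Real.exp (-|z| / (2 * b)) := by
          rw [← Real.exp_add, ← add_div]
          refine Real.exp_le_exp.mpr ?_
          rw [div_le_div_iff₀ hb (by positivity)]
          have : t ≤ |z| := hz
          nlinarith
        calc 1 / (2 * b) * Real.exp (-|z| / b)
            ≤ 1 / (2 * b) * (Real.exp (-t / (2 * b)) * Real.exp (-|z| / (2 * b))) := by gcongr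
          _ = _ := by field_simp
    _ = ENNReal.ofReal (2 * Real.exp (-t / (2 * b))) * laplace (2 * b) {z | t ≤ |z|} := by
        rw [lintegral_const_mul _ (by fun_prop), laplace, withDensity_apply _ hms]
    _ ≤ _ := mul_le_of_le_one_right' prob_le_one

theorem laplace_tail_le_of_le {b t : ℝ} (hb : 0 < b) (ht : 10 * b ≤ t) :
    laplace b {z | t ≤ |z|} ≤ ENNReal.ofReal (1 / 20) := by
  refine (laplace_tail_le hb).trans (ENNReal.ofReal_le_ofReal ?_)
  have h1 : Real.exp (-t / (2 * b)) ≤ Real.exp (-5) := by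
    refine Real.exp_le_exp.mpr ?_
    rw [div_le_iff₀ (by positivity)]
    linarith
  have h2 : Real.exp (-5) ≤ 1 / 40 := by
    rw [Real.exp_neg, show (5 : ℝ) = ((5 : ℕ) : ℝ) * 1 by norm_num, Real.exp_nat_mul, one_div]
    refine inv_anti₀ (by norm_num) ?_
    calc (40 : ℝ) ≤ 2.7 ^ 5 := by norm_num
      _ ≤ Real.exp 1 ^ 5 := pow_le_pow_left₀ (by norm_num) (by linarith [Real.exp_one_gt_d9]) 5
  linarith

/-- Shifting the noise changes the probability of an event by a bounded factor. -/
theorem laplace_preimage_add_le {b ξ u v : ℝ} (hb : 0 < b) (huv : |u - v| ≤ b * ξ) {s : Set ℝ}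
    (hs : MeasurableSet s) :
    laplace b ((fun z => u + z) ⁻¹' s) ≤
      ENNReal.ofReal (Real.exp ξ) * laplace b ((fun z => v + z) ⁻¹' s) := by
  have key : ∀ u : ℝ, laplace b ((fun z => u + z) ⁻¹' s) =
      ∫⁻ y in s, ENNReal.ofReal (1 / (2 * b) * Real.exp (-|y - u| / b)) := by
    intro u
    rw [laplace, withDensity_apply _ (measurable_const_add u hs)]
    rw [← (measurePreserving_add_left (volume : Measure ℝ) u).setLIntegral_comp_preimage hs
      (by fun_prop)]
    simp
  rw [key, key, ← lintegral_const_mul _ (by fun_prop)]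
  refine lintegral_mono fun y => ?_
  rw [← ENNReal.ofReal_mul (by positivity)]
  refine ENNReal.ofReal_le_ofReal ?_
  have h1 : Real.exp (-|y - u| / b) ≤ Real.exp ξ * Real.exp (-|y - v| / b) := by
    rw [← Real.exp_add]
    refine Real.exp_le_exp.mpr ?_
    rw [add_div' _ _ _ hb.ne', div_le_div_iff_of_pos_right hb]
    have : |y - v| ≤ |y - u| + |u - v| := abs_sub_le _ _ _
    linarith
  calc 1 / (2 * b) * Real.exp (-|y - u| / b)
      ≤ 1 / (2 * b) * (Real.exp ξ * Real.exp (-|y - v| / b)) := by gcongr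
    _ = _ := by ring

end laplace

/-! ### Noisy additive statistics: privacy and error probability. -/

namespace SampleAlgorithm

variable {n : ℕ}

/-- The algorithm that answers `g` at a noisy additive statistic of the counts. -/
noncomputable def noisyAdditive (s : ℕ) (φ : Fin n → ℕ → ℝ) (b : ℝ) (g : ℝ → Answer) :
    SampleAlgorithm n where
  numSamples := s
  run x := (laplace b).map fun z => g (additive φ (counts x) + z)

variable {s : ℕ} {φ : Fin n → ℕ → ℝ} {b : ℝ} {g : ℝ → Answer}

theorem isRandomized_noisyAdditive (hb : 0 < b) (hg : Measurable g) :
    (noisyAdditive s φ b g).IsRandomized := fun _ =>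
  have := isProbabilityMeasure_laplace hb
  Measure.isProbabilityMeasure_map (hg.comp (measurable_const_add _)).aemeasurable

theorem run_noisyAdditive (hg : Measurable g) (x : Fin s → Fin n) (O : Set Answer) :
    (noisyAdditive s φ b g).run x O =
      laplace b ((fun z => additive φ (counts x) + z) ⁻¹' (g ⁻¹' O)) :=
  Measure.map_apply (hg.comp (measurable_const_add _)) trivial

theorem isDP_noisyAdditive (hb : 0 < b) (hg : Measurable g) {l u ξ : ℝ}
    (hφ : ∀ i k, l ≤ φ i (k + 1) - φ i k ∧ φ i (k + 1) - φ i k ≤ u) (hξ : u - l ≤ b * ξ) :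
    (noisyAdditive s φ b g).IsDP ξ := by
  intro (x : Fin s → Fin n) (x' : Fin s → Fin n) h O
  have := laplace_preimage_add_le hb ((abs_additive_counts_sub_le hφ h).trans hξ)
    (hg (t := O) trivial)
  rwa [← run_noisyAdditive hg, ← run_noisyAdditive hg] at this

/-- If an unlikely deviation of the statistic or of the noise is needed for an answer in `O`,
then such an answer is unlikely. -/
theorem prob_noisyAdditive_le (hb : 0 < b) (hg : Measurable g) (p : PMF (Fin n)) {O : Set Answer}
    {a t V : ℝ} (ha : 0 < a) (ht : 10 * b ≤ t)
    (hV : (s : ℝ) * ∑ i, (p i).toReal *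
      binExp (p i).toReal (s - 1) (fun k => (φ i (k + 1) - φ i k) ^ 2) ≤ V)
    (hVa : 20 * V ≤ a ^ 2)
    (hO : ∀ y z : ℝ, g (y + z) ∈ O →
      |y - ∑ i, binExp (p i).toReal s (φ i)| < a → t ≤ |z|) :
    (noisyAdditive s φ b g).prob p O ≤ ENNReal.ofReal (1 / 10) := by
  have := isProbabilityMeasure_laplace hb
  set m := ∑ i, binExp (p i).toReal s (φ i) with hm
  have hmean : countExp (fun i => (p i).toReal) s (additive φ) = m :=
    countExp_additive (sum_toReal_eq_one p) s φ
  set Bad : Set (Fin s → Fin n) := {x | a ≤ |additive φ (counts x) - m|}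
  have hBad : (Measure.pi fun _ : Fin s => p.toMeasure) Bad ≤ ENNReal.ofReal (1 / 20) := by
    refine (measure_le_abs_counts_sub p s (additive φ) m ha).trans (ENNReal.ofReal_le_ofReal ?_)
    rw [div_le_iff₀ (by positivity), ← hmean]
    have := variance_additive_le (p := fun i => (p i).toReal)
      (fun i => ENNReal.toReal_nonneg) (sum_toReal_eq_one p) s φ
    linarith
  have hrun : ∀ x : Fin s → Fin n, (noisyAdditive s φ b g).run x O ≤
      Bad.indicator 1 x + ENNReal.ofReal (1 / 20) := by
    intro x
    rw [run_noisyAdditive hg]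
    by_cases hx : x ∈ Bad
    · rw [Set.indicator_of_mem hx]
      exact prob_le_one.trans le_self_add
    · refine le_add_left ((measure_mono fun z hz => ?_).trans (laplace_tail_le_of_le hb ht))
      exact hO _ z hz (not_le.mp hx)
  calc (noisyAdditive s φ b g).prob p O
      ≤ ∫⁻ x, (Bad.indicator 1 x + ENNReal.ofReal (1 / 20))
          ∂(Measure.pi fun _ : Fin s => p.toMeasure) := lintegral_mono hrun
    _ ≤ ENNReal.ofReal (1 / 20) + ENNReal.ofReal (1 / 20) := by
        rw [lintegral_add_right _ measurable_const, lintegral_const, measure_univ, mul_one,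
          lintegral_indicator_one (Set.toFinite _).measurableSet]
        gcongr
    _ = ENNReal.ofReal (1 / 10) := by
        rw [← ENNReal.ofReal_add] <;> norm_num

end SampleAlgorithm

/-! ### Total variation distance and the Scheffé set. -/

section tv

variable {n : ℕ}

theorem bddAbove_range_abs_mass_sub (p q : PMF (Fin n)) :
    BddAbove (Set.range fun S : Finset (Fin n) => |mass p S - mass q S|) :=
  (Set.finite_range _).bddAbove

theorem abs_mass_sub_le_tv (p q : PMF (Fin n)) (S : Finset (Fin n)) :
    |mass p S - mass q S| ≤ tv p q :=
  le_ciSup (bddAbove_range_abs_mass_sub p q) S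

theorem mass_add_mass_compl (p : PMF (Fin n)) (S : Finset (Fin n)) :
    mass p S + mass p Sᶜ = 1 := by
  rw [mass, mass, Finset.sum_add_sum_compl, sum_toReal_eq_one]

theorem mass_nonneg (p : PMF (Fin n)) (S : Finset (Fin n)) : 0 ≤ mass p S :=
  Finset.sum_nonneg fun _ _ => ENNReal.toReal_nonneg

theorem mass_le_one (p : PMF (Fin n)) (S : Finset (Fin n)) : mass p S ≤ 1 := by
  linarith [mass_add_mass_compl p S, mass_nonneg p Sᶜ]

theorem tv_le_one (p q : PMF (Fin n)) : tv p q ≤ 1 :=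
  ciSup_le fun S => abs_le.mpr ⟨by linarith [mass_nonneg p S, mass_le_one q S],
    by linarith [mass_nonneg q S, mass_le_one p S]⟩

/-- An event and its complement have the same absolute mass difference, and together they cover the
sum once. -/
theorem two_mul_tv_le (p q : PMF (Fin n)) :
    2 * tv p q ≤ ∑ i, |(p i).toReal - (q i).toReal| := by
  have : tv p q ≤ (∑ i, |(p i).toReal - (q i).toReal|) / 2 := by
    refine ciSup_le fun S => ?_
    have h1 : ∀ U : Finset (Fin n),
        |mass p U - mass q U| ≤ ∑ i ∈ U, |(p i).toReal - (q i).toReal| := fun U => by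
      rw [mass, mass, ← Finset.sum_sub_distrib]
      exact Finset.abs_sum_le_sum_abs _ _
    have h2 : |mass p Sᶜ - mass q Sᶜ| = |mass p S - mass q S| := by
      rw [← abs_neg]
      congr 1
      linarith [mass_add_mass_compl p S, mass_add_mass_compl q S]
    have h3 := Finset.sum_add_sum_compl S fun i => |(p i).toReal - (q i).toReal|
    linarith [h1 S, h1 Sᶜ]
  linarith

/-- The Scheffé set attains the total variation distance. -/
theorem tv_le_mass_scheffeSet (phat q : PMF (Fin n)) :
    tv phat q ≤ mass q (scheffeSet phat q) - mass phat (scheffeSet phat q) := by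
  have h : ∀ U : Finset (Fin n), mass q U - mass phat U ≤
      mass q (scheffeSet phat q) - mass phat (scheffeSet phat q) := by
    intro U
    simp only [mass, ← Finset.sum_sub_distrib]
    calc ∑ i ∈ U, ((q i).toReal - (phat i).toReal)
        ≤ ∑ i ∈ U, max ((q i).toReal - (phat i).toReal) 0 :=
          Finset.sum_le_sum fun i _ => le_max_left _ _
      _ ≤ ∑ i, max ((q i).toReal - (phat i).toReal) 0 :=
          Finset.sum_le_univ_sum_of_nonneg fun i => le_max_right _ _
      _ = ∑ i ∈ scheffeSet phat q, ((q i).toReal - (phat i).toReal) := by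
          rw [scheffeSet, Finset.sum_filter]
          refine Finset.sum_congr rfl fun i _ => ?_
          split_ifs with hi
          · exact max_eq_left (by linarith)
          · exact max_eq_right (by linarith)
  refine ciSup_le fun U => abs_le.mpr ⟨by linarith [h U], ?_⟩
  linarith [h Uᶜ, mass_add_mass_compl phat U, mass_add_mass_compl q U]

theorem tv_sub_le_abs_mass_sub {p phat q : PMF (Fin n)} {α : ℝ} (h : tv p phat ≤ α) :
    tv phat q - α ≤ |mass p (scheffeSet phat q) - mass q (scheffeSet phat q)| := by
  have h1 := tv_le_mass_scheffeSet phat q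
  have h2 := (abs_mass_sub_le_tv p phat (scheffeSet phat q)).trans h
  rw [abs_sub_comm (mass p _)]
  exact le_abs.mpr (Or.inl (by linarith [(abs_le.mp h2).2]))

end tv

/-! ### The noisy Scheffé test. -/

section scheffe

variable {n : ℕ}

theorem scheffeRate_pos {γ ξ : ℝ} (hγ : 0 < γ) (hξ : 0 < ξ) : 0 < scheffeRate γ ξ := by
  unfold scheffeRate; positivity

theorem one_le_scheffeRate {γ ξ : ℝ} (hγ : 0 < γ) (hγ1 : γ ≤ 1) (hξ : 0 < ξ) :
    1 ≤ scheffeRate γ ξ := by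
  have h1 : 1 ≤ 1 / γ ^ 2 := (one_le_div (by positivity)).mpr (pow_le_one₀ hγ.le hγ1)
  have h2 : 0 ≤ 1 / (γ * ξ) := by positivity
  unfold scheffeRate; linarith

theorem isThetaWith_ceil {K C r : ℝ} (hK : 1 ≤ K) (hC : K + 1 ≤ C) (hr : 1 ≤ r) :
    IsThetaWith 1 C ⌈K * r⌉₊ r := by
  constructor
  · exact (mul_le_mul_of_nonneg_right hK (by linarith)).trans (Nat.le_ceil _)
  · have := Nat.ceil_lt_add_one (a := K * r) (by nlinarith)
    nlinarith

/-- The summands that turn the counts into the fraction of the samples in `S`. -/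
noncomputable def fractionSummand (S : Finset (Fin n)) (s : ℕ) (i : Fin n) (k : ℕ) : ℝ :=
  if i ∈ S then 1 / (s : ℝ) * k else 0

theorem additive_fractionSummand (S : Finset (Fin n)) {s : ℕ} (x : Fin s → Fin n) :
    additive (fractionSummand S s) (counts x) = sampleFraction S x := by
  have : ∀ i, fractionSummand S s i (counts x i) =
      ∑ j, 1 / (s : ℝ) * if x j = i then (if i ∈ S then 1 else 0) else 0 := by
    intro i
    simp only [fractionSummand, counts, Finset.sum_apply, Pi.single_apply, ← Finset.mul_sum]
    split_ifs with h
    · simp [eq_comm]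
    · simp
  rw [additive, Finset.sum_congr rfl fun i _ => this i, Finset.sum_comm]
  simp only [← Finset.mul_sum, sampleFraction]
  simp

theorem fractionSummand_succ_sub (S : Finset (Fin n)) (s : ℕ) (i : Fin n) (k : ℕ) :
    0 ≤ fractionSummand S s i (k + 1) - fractionSummand S s i k ∧
      fractionSummand S s i (k + 1) - fractionSummand S s i k ≤ 1 / (s : ℝ) := by
  unfold fractionSummand
  split_ifs
  · push_cast
    constructor
    · have : (0 : ℝ) ≤ 1 / s := by positivity
      linarith
    · linarith
  · simp

theorem sum_binExp_fractionSummand (p : PMF (Fin n)) (S : Finset (Fin n)) {s : ℕ} (hs : s ≠ 0) :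
    ∑ i, binExp (p i).toReal s (fractionSummand S s i) = mass p S := by
  have : ∀ i, binExp (p i).toReal s (fractionSummand S s i) = if i ∈ S then (p i).toReal else 0 := by
    intro i
    by_cases h : i ∈ S
    · have h2 : fractionSummand S s i = fun k : ℕ => 1 / (s : ℝ) * (k : ℝ) := by
        funext k; simp [fractionSummand, h]
      rw [h2, binExp_const_mul, binExp_natCast, if_pos h]
      field_simp
    · have h2 : fractionSummand S s i = fun _ => 0 := by
        funext k; simp [fractionSummand, h]
      rw [h2, binExp_const, if_neg h]
  rw [Finset.sum_congr rfl fun i _ => this i, mass, Finset.sum_ite_mem, Finset.univ_inter]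

/-- The answer of the noisy Scheffé test at the noisy fraction `y`. -/
noncomputable def scheffeAnswer (c γ y : ℝ) : Answer :=
  open Classical in if |y - c| > γ / 4 then Answer.reject else Answer.bot

theorem measurable_scheffeAnswer (c γ : ℝ) : Measurable (scheffeAnswer c γ) := by
  classical
  exact Measurable.ite (measurableSet_lt measurable_const (by fun_prop)) measurable_const
    measurable_const

theorem scheffeTester_eq (K : ℝ) (q phat : PMF (Fin n)) (α ξ : ℝ) :
    scheffeTester K q phat α ξ =
      SampleAlgorithm.noisyAdditive ⌈K * scheffeRate (tv phat q - α) ξ⌉₊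
        (fractionSummand (scheffeSet phat q) ⌈K * scheffeRate (tv phat q - α) ξ⌉₊)
        (1 / ((⌈K * scheffeRate (tv phat q - α) ξ⌉₊ : ℝ) * ξ))
        (scheffeAnswer (mass q (scheffeSet phat q)) (tv phat q - α)) := by
  unfold scheffeTester SampleAlgorithm.noisyAdditive
  congr 1
  funext x
  congr 1
  funext z
  rw [additive_fractionSummand]
  unfold scheffeAnswer
  congr

/-- The statistic may deviate by `γ/8` and the noise by `γ/8`, against a threshold of `γ/4` and a
separation of `γ`. Chebyshev needs `20/s ≤ (γ/8)²`, which is where `1280 = 20 · 64` comes from; the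
noise needs only `s γ ξ ≥ 80`. -/
theorem isPrivateAugmentedTester_scheffeTester {K : ℝ} (hK : 1280 ≤ K) (q phat : PMF (Fin n))
    {α ξ : ℝ} (ε : ℝ) (hα : α < tv phat q) (hξ : 0 < ξ) :
    (scheffeTester K q phat α ξ).IsPrivateAugmentedTester ξ ε α (1 / 10) phat {q} := by
  rw [scheffeTester_eq]
  set γ := tv phat q - α with hγdef
  set S := scheffeSet phat q
  set s := ⌈K * scheffeRate γ ξ⌉₊ with hs
  set b := 1 / ((s : ℝ) * ξ) with hbdef
  have hγ : 0 < γ := sub_pos.mpr hα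
  have hsK : K * scheffeRate γ ξ ≤ s := Nat.le_ceil _
  have hs0 : (0 : ℝ) < s :=
    lt_of_lt_of_le (mul_pos (by linarith) (scheffeRate_pos hγ hξ)) hsK
  have hb : 0 < b := by positivity
  have hs1 : 1280 ≤ s * γ ^ 2 := by
    have h1 : K * (1 / γ ^ 2) ≤ s := le_trans (mul_le_mul_of_nonneg_left
      (le_add_of_nonneg_right (by positivity)) (by linarith)) hsK
    rw [mul_one_div, div_le_iff₀ (by positivity)] at h1
    linarith
  have hs2 : 1280 ≤ s * (γ * ξ) := by
    have h1 : K * (1 / (γ * ξ)) ≤ s := le_trans (mul_le_mul_of_nonneg_left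
      (le_add_of_nonneg_left (by positivity)) (by linarith)) hsK
    rw [mul_one_div, div_le_iff₀ (by positivity)] at h1
    linarith
  have ht : 10 * b ≤ γ / 8 := by
    rw [hbdef, mul_one_div, div_le_iff₀ (by positivity)]
    nlinarith
  have hg := measurable_scheffeAnswer (mass q S) γ
  have hslope := fractionSummand_succ_sub S s
  have hV : ∀ p : PMF (Fin n), (s : ℝ) * ∑ i, (p i).toReal * binExp (p i).toReal (s - 1)
      (fun k => (fractionSummand S s i (k + 1) - fractionSummand S s i k) ^ 2) ≤ 1 / s := by
    intro p
    have hle : ∀ i, (p i).toReal ≤ 1 := fun i => by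
      simpa [mass] using mass_le_one p {i}
    have : ∑ i, (p i).toReal * binExp (p i).toReal (s - 1)
        (fun k => (fractionSummand S s i (k + 1) - fractionSummand S s i k) ^ 2) ≤
        ∑ i, (p i).toReal * (1 / s) ^ 2 := by
      refine Finset.sum_le_sum fun i _ => mul_le_mul_of_nonneg_left ?_ ENNReal.toReal_nonneg
      rw [← binExp_const (x := (p i).toReal) (s - 1) ((1 / (s : ℝ)) ^ 2)]
      exact binExp_mono ENNReal.toReal_nonneg (hle i) _ fun k =>
        pow_le_pow_left₀ (hslope i k).1 (hslope i k).2 2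
    rw [← Finset.sum_mul, sum_toReal_eq_one, one_mul] at this
    calc _ ≤ (s : ℝ) * (1 / s) ^ 2 := mul_le_mul_of_nonneg_left this hs0.le
      _ = 1 / s := by field_simp
  have hVa : 20 * (1 / (s : ℝ)) ≤ (γ / 8) ^ 2 := by
    rw [mul_one_div, div_le_iff₀ hs0]
    nlinarith
  have hsne : s ≠ 0 := by exact_mod_cast hs0.ne'
  refine ⟨SampleAlgorithm.isRandomized_noisyAdditive hb hg,
    SampleAlgorithm.isDP_noisyAdditive hb hg hslope ?_, ?_, ?_, ?_⟩
  · rw [hbdef]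
    exact le_of_eq (by field_simp; ring)
  · rintro p rfl
    refine SampleAlgorithm.prob_noisyAdditive_le hb hg p (by positivity) ht (hV p) hVa ?_
    intro y z hyz hy
    rw [sum_binExp_fractionSummand p S hsne] at hy
    simp only [scheffeAnswer, Set.mem_singleton_iff, ite_eq_left_iff, reduceCtorEq, imp_false,
      not_not] at hyz
    have := abs_add_le (y - mass p S) z
    rw [show y - mass p S + z = y + z - mass p S by ring] at this
    linarith
  · intro p _
    refine SampleAlgorithm.prob_noisyAdditive_le hb hg p (by positivity) ht (hV p) hVa ?_
    intro y z hyz _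
    simp only [scheffeAnswer, Set.mem_singleton_iff] at hyz
    split_ifs at hyz
  · intro p hp
    refine SampleAlgorithm.prob_noisyAdditive_le hb hg p (by positivity) ht (hV p) hVa ?_
    intro y z hyz hy
    rw [sum_binExp_fractionSummand p S hsne] at hy
    simp only [scheffeAnswer, Set.mem_singleton_iff, ite_eq_right_iff, reduceCtorEq, imp_false,
      not_lt] at hyz
    have h1 : γ ≤ |mass p S - mass q S| := tv_sub_le_abs_mass_sub hp
    have h2 := abs_add_three (mass p S - y) (-z) (y + z - mass q S)
    rw [show mass p S - y + -z + (y + z - mass q S) = mass p S - mass q S by ring, abs_neg,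
      abs_sub_comm _ y] at h2
    linarith

end scheffe

/-! ### The Huber potential of a single count: mean growth and variance. -/

section clipped

/-- The slope `(k - l) / w`, clipped to `[-D, D]`. -/
noncomputable def clippedSlope (D w l : ℝ) (k : ℕ) : ℝ := max (-D) (min D ((k - l) / w))

/-- A convex potential with slopes at most `2 D` in absolute value: the slopes are the clipped
slopes around the expected count `s q`, shifted to have mean `0` when the distribution is `q`. -/
noncomputable def huber (D w q : ℝ) (s : ℕ) (k : ℕ) : ℝ :=
  ∑ j ∈ Finset.range k,
    (clippedSlope D w (s * q) j - binExp q (s - 1) (clippedSlope D w (s * q)))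

theorem huber_succ_sub (D w q : ℝ) (s k : ℕ) : huber D w q s (k + 1) - huber D w q s k =
    clippedSlope D w (s * q) k - binExp q (s - 1) (clippedSlope D w (s * q)) := by
  rw [huber, Finset.sum_range_succ, huber, add_sub_cancel_left]

variable {D w l : ℝ}

theorem abs_clippedSlope_le (hD : 0 ≤ D) (k : ℕ) : |clippedSlope D w l k| ≤ D :=
  abs_le.mpr ⟨le_max_left _ _, max_le (by linarith) (min_le_left _ _)⟩

theorem clippedSlope_mono (hw : 0 < w) (k : ℕ) :
    clippedSlope D w l k ≤ clippedSlope D w l (k + 1) := by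
  unfold clippedSlope
  push_cast
  gcongr
  linarith

theorem abs_clip_sub_le (D a b : ℝ) :
    |max (-D) (min D a) - max (-D) (min D b)| ≤ |a - b| :=
  (abs_max_sub_max_le_max _ _ _ _).trans
    (max_le (by simp) ((abs_min_sub_min_le_max _ _ _ _).trans (max_le (by simp) le_rfl)))

theorem clippedSlope_succ_sub_le (hw : 0 < w) (k : ℕ) :
    clippedSlope D w l (k + 1) - clippedSlope D w l k ≤ 1 / w := by
  refine (le_abs_self _).trans ((abs_clip_sub_le D _ _).trans_eq ?_)
  rw [← sub_div, abs_div, abs_of_pos hw]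
  push_cast
  congr 1
  rw [show (k : ℝ) + 1 - l - (k - l) = 1 by ring, abs_one]

/-- Within `D w / 2` of the centre neither slope is clipped, as `D w ≥ 2`; farther out the left side
is nonpositive. The quadratic minorant needs only a second moment when averaged. -/
theorem le_clippedSlope_succ_sub (hw : 0 < w) (hDw : 2 ≤ D * w) (k : ℕ) :
    1 / w * (1 - 4 / (D * w) ^ 2 * ((k : ℝ) - l) ^ 2) ≤
      clippedSlope D w l (k + 1) - clippedSlope D w l k := by
  have h0 : 0 < D * w := by linarith
  by_cases h : |(k : ℝ) - l| ≤ D * w / 2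
  · have h1 := abs_le.mp h
    have e : ∀ y : ℝ, -(D * w) ≤ y → y ≤ D * w → max (-D) (min D (y / w)) = y / w := by
      intro y hy1 hy2
      rw [min_eq_right ((div_le_iff₀ hw).mpr hy2), max_eq_right ((le_div_iff₀ hw).mpr (by linarith))]
    unfold clippedSlope
    push_cast
    rw [e _ (by linarith) (by linarith), e _ (by linarith) (by linarith), ← sub_div,
      show (k : ℝ) + 1 - l - (k - l) = 1 by ring]
    refine mul_le_of_le_one_right (by positivity) ?_
    have : 0 ≤ 4 / (D * w) ^ 2 * ((k : ℝ) - l) ^ 2 := by positivity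
    linarith
  · have h1 : (D * w / 2) ^ 2 ≤ ((k : ℝ) - l) ^ 2 := by
      rw [← sq_abs ((k : ℝ) - l)]
      exact pow_le_pow_left₀ (by linarith) (not_le.mp h).le 2
    have h2 : 1 ≤ 4 / (D * w) ^ 2 * ((k : ℝ) - l) ^ 2 := by
      rw [div_mul_eq_mul_div, one_le_div (by positivity)]
      linarith
    have h3 : 1 / w * (1 - 4 / (D * w) ^ 2 * ((k : ℝ) - l) ^ 2) ≤ 0 :=
      mul_nonpos_of_nonneg_of_nonpos (by positivity) (by linarith)
    linarith [clippedSlope_mono (D := D) (l := l) hw k]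

variable {s : ℕ} {p q : ℝ}

theorem monotoneOn_binExp_clippedSlope (hw : 0 < w) (s : ℕ) :
    MonotoneOn (fun x => binExp x s (clippedSlope D w l)) (Set.Icc 0 1) := by
  have hd := hasDerivAt_binExp s (clippedSlope D w l)
  refine monotoneOn_of_deriv_nonneg (convex_Icc 0 1)
    (fun x _ => (hd x).continuousAt.continuousWithinAt)
    (fun x _ => (hd x).differentiableAt.differentiableWithinAt) fun x hx => ?_
  rw [interior_Icc] at hx
  rw [(hd x).deriv]
  refine mul_nonneg (Nat.cast_nonneg _) ?_
  rw [← binExp_const (x := x) (s - 1) 0]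
  exact binExp_mono hx.1.le hx.2.le _ fun k => sub_nonneg.mpr (clippedSlope_mono hw k)

/-- Around the expected count the mean slope grows at least linearly. -/
theorem mul_sub_le_binExp_clippedSlope_sub (hs : 2 ≤ s) (hw : 0 < w) (hDw : 10 ≤ D * w)
    (hl : 400 * (s * q) ≤ (D * w) ^ 2) {x y : ℝ} (hx0 : 0 ≤ x) (hxy : x ≤ y)
    (hy1 : y ≤ 1) (hx : -(D * w / 10) ≤ s * (x - q)) (hy : s * (y - q) ≤ D * w / 10) :
    s / (4 * w) * (y - x) ≤ binExp y (s - 1) (clippedSlope D w (s * q)) -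
      binExp x (s - 1) (clippedSlope D w (s * q)) := by
  have hd := hasDerivAt_binExp (s - 1) (clippedSlope D w (s * q))
  refine (convex_Icc x y).mul_sub_le_image_sub_of_le_deriv
    (fun z _ => (hd z).continuousAt.continuousWithinAt)
    (fun z _ => (hd z).differentiableAt.differentiableWithinAt) (fun z hz => ?_)
    x (Set.left_mem_Icc.mpr hxy) y (Set.right_mem_Icc.mpr hxy) hxy
  rw [interior_Icc] at hz
  obtain ⟨hzx, hzy⟩ := hz
  have hs' : (2 : ℝ) ≤ s := by exact_mod_cast hs
  have hz0 : 0 ≤ z := hx0.trans hzx.le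
  have hz1 : z ≤ 1 := hzy.le.trans hy1
  rw [(hd z).deriv]
  have h1 := binExp_mono hz0 hz1 (s - 1 - 1)
    (le_clippedSlope_succ_sub (l := s * q) hw (by linarith : 2 ≤ D * w))
  rw [binExp_const_mul, binExp_sub, binExp_const, binExp_const_mul, binExp_natCast_sub_sq] at h1
  have hc2 : ((s - 1 - 1 : ℕ) : ℝ) = s - 2 := by
    rw [Nat.sub_sub, Nat.cast_sub hs]; norm_num
  have hc1 : ((s - 1 : ℕ) : ℝ) = s - 1 := by
    rw [Nat.cast_sub (by omega)]; norm_num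
  rw [hc2] at h1
  rw [hc1]
  set R := D * w / 10 with hR
  have hDR : D * w = 10 * R := by rw [hR]; ring
  rw [hDR] at h1 hl hDw
  have hu1 : s * (z - q) ≤ R := le_trans (by gcongr) hy
  have hu2 : -R ≤ s * (z - q) := hx.trans (by gcongr)
  -- The variance is at most `s z ≤ s q + R ≤ R²/4 + R` and the bias at most `R + 2`, with `R ≥ 1`.
  -- The constant `12.5` makes the loss in `h3` exactly one half.
  have h2 : (s - 2) * z * (1 - z) + ((s - 2) * z - s * q) ^ 2 ≤ 12.5 * R ^ 2 := by
    have e1 : (s - 2) * z * (1 - z) ≤ s * z := by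
      have : (s - 2) * z * (1 - z) ≤ (s - 2) * z * 1 :=
        mul_le_mul_of_nonneg_left (by linarith) (mul_nonneg (by linarith) hz0)
      linarith
    have e2 : ((s - 2) * z - s * q) ^ 2 ≤ (R + 2) ^ 2 := sq_le_sq' (by nlinarith) (by nlinarith)
    nlinarith
  have h3 : 1 / w * (1 / 2) ≤
      1 / w * (1 - 4 / (10 * R) ^ 2 * ((s - 2) * z * (1 - z) + ((s - 2) * z - s * q) ^ 2)) := by
    gcongr
    have : 4 / (10 * R) ^ 2 * ((s - 2) * z * (1 - z) + ((s - 2) * z - s * q) ^ 2) ≤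
        4 / (10 * R) ^ 2 * (12.5 * R ^ 2) := by gcongr
    have hR0 : R ≠ 0 := by linarith
    have e : 4 / (10 * R) ^ 2 * (12.5 * R ^ 2) = 1 / 2 := by field_simp; norm_num
    linarith
  calc s / (4 * w) = (s / 2) * (1 / w * (1 / 2)) := by field_simp; norm_num
    _ ≤ (s - 1) * (1 / w * (1 / 2)) := by gcongr; linarith
    _ ≤ _ := mul_le_mul_of_nonneg_left (h3.trans h1) (by linarith)

theorem hasDerivAt_binExp_huber (D w q : ℝ) (s : ℕ) (x : ℝ) :
    HasDerivAt (fun y => binExp y s (huber D w q s))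
      (s * (binExp x (s - 1) (clippedSlope D w (s * q)) -
        binExp q (s - 1) (clippedSlope D w (s * q)))) x := by
  have := hasDerivAt_binExp s (huber D w q s) x
  simp only [huber_succ_sub] at this
  rwa [binExp_sub, binExp_const] at this

/-- The mean of the potential grows away from `q`. -/
theorem binExp_huber_sub_ge (hs : 2 ≤ s) (hw : 0 < w) (hDw : 10 ≤ D * w)
    (hq0 : 0 ≤ q) (hq1 : q ≤ 1) (hp0 : 0 ≤ p) (hp1 : p ≤ 1)
    (hl : 400 * (s * q) ≤ (D * w) ^ 2) :
    1 / 80 * (|s * (p - q)| * min (|s * (p - q)| / w) D) ≤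
      binExp p s (huber D w q s) - binExp q s (huber D w q s) := by
  have hs0 : (0 : ℝ) < s := by exact_mod_cast (by omega : 0 < s)
  set h : ℝ → ℝ := fun x => binExp x (s - 1) (clippedSlope D w (s * q)) with hh
  set H : ℝ → ℝ := fun x => binExp x s (huber D w q s) with hH
  have hmono : MonotoneOn h (Set.Icc 0 1) := monotoneOn_binExp_clippedSlope hw _
  have hd : ∀ x, HasDerivAt H (s * (h x - h q)) x := hasDerivAt_binExp_huber D w q s
  have hcont : ∀ u : Set ℝ, ContinuousOn H u := fun u x _ =>
    (hd x).continuousAt.continuousWithinAt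
  have hdiff : ∀ u : Set ℝ, DifferentiableOn ℝ H u := fun u x _ =>
    (hd x).differentiableAt.differentiableWithinAt
  set R := D * w / 10 with hR
  have hRs : 0 < R / s := by apply div_pos <;> linarith
  have hsR : s * (R / s) = R := by field_simp
  -- the final computation
  have hfin : ∀ d : ℝ, 0 ≤ d → 1 / 80 * (s * d * min (s * d / w) D) ≤
      s * (s / (4 * w) * min (d / 2) (R / s)) * (d / 2) := by
    intro d hd0
    have e : s * (s / (4 * w) * min (d / 2) (R / s)) * (d / 2) =
        s * d * (min (d / 2) (R / s) * (s / (8 * w))) := by field_simp; ring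
    rw [e, mul_left_comm]
    refine mul_le_mul_of_nonneg_left ?_ (by positivity)
    rw [min_mul_of_nonneg _ _ (by positivity : 0 ≤ s / (8 * w))]
    refine le_min ?_ ?_
    · calc 1 / 80 * min (s * d / w) D ≤ 1 / 16 * (s * d / w) :=
            mul_le_mul (by norm_num) (min_le_left _ _)
              (le_min (by positivity) (by nlinarith)) (by norm_num)
        _ = _ := by field_simp; ring
    · calc 1 / 80 * min (s * d / w) D ≤ 1 / 80 * D := by gcongr; exact min_le_right _ _
        _ = _ := by rw [hR]; field_simp; ring
  rcases le_total q p with hqp | hpq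
  · have hm0 : 0 ≤ (q + p) / 2 := by linarith
    have hlow : s / (4 * w) * min ((p - q) / 2) (R / s) ≤ h ((q + p) / 2) - h q := by
      have h1 := mul_sub_le_binExp_clippedSlope_sub hs hw hDw hl (x := q)
        (y := q + min ((p - q) / 2) (R / s)) hq0
        (le_add_of_nonneg_right (le_min (by linarith) hRs.le))
        (by linarith [min_le_left ((p - q) / 2) (R / s)]) (by rw [sub_self, mul_zero]; linarith)
        (by rw [add_sub_cancel_left, ← hR, ← hsR]; gcongr; rw [hsR]; exact min_le_right _ _)
      rw [add_sub_cancel_left] at h1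
      have h2 : h (q + min ((p - q) / 2) (R / s)) ≤ h ((q + p) / 2) := by
        refine hmono ⟨add_nonneg hq0 (le_min (by linarith) hRs.le), ?_⟩ ⟨hm0, by linarith⟩ ?_ <;>
          linarith [min_le_left ((p - q) / 2) (R / s)]
      linarith
    have hA : 0 * ((q + p) / 2 - q) ≤ H ((q + p) / 2) - H q := by
      refine (convex_Icc q 1).mul_sub_le_image_sub_of_le_deriv (hcont _) (hdiff _)
        (fun z hz => ?_) q ⟨le_rfl, hq1⟩ _ ⟨by linarith, by linarith⟩ (by linarith)
      rw [interior_Icc] at hz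
      rw [(hd z).deriv]
      exact mul_nonneg hs0.le (sub_nonneg.mpr (hmono ⟨hq0, hq1⟩ ⟨hq0.trans hz.1.le, hz.2.le⟩ hz.1.le))
    have hB : s * (h ((q + p) / 2) - h q) * (p - (q + p) / 2) ≤ H p - H ((q + p) / 2) := by
      refine (convex_Icc ((q + p) / 2) 1).mul_sub_le_image_sub_of_le_deriv (hcont _) (hdiff _)
        (fun z hz => ?_) _ ⟨le_rfl, by linarith⟩ p ⟨by linarith, hp1⟩ (by linarith)
      rw [interior_Icc] at hz
      rw [(hd z).deriv]
      gcongr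
      exact hmono ⟨hm0, by linarith⟩ ⟨hm0.trans hz.1.le, hz.2.le⟩ hz.1.le
    have hC : s * (s / (4 * w) * min ((p - q) / 2) (R / s)) * ((p - q) / 2) ≤
        s * (h ((q + p) / 2) - h q) * (p - (q + p) / 2) := by
      rw [show p - (q + p) / 2 = (p - q) / 2 by ring]
      have : 0 ≤ (p - q) / 2 := by linarith
      gcongr
    have := hfin (p - q) (by linarith)
    rw [abs_of_nonneg (mul_nonneg hs0.le (sub_nonneg.mpr hqp))]
    linarith
  · have hm0 : 0 ≤ (q + p) / 2 := by linarith
    have hlow : s / (4 * w) * min ((q - p) / 2) (R / s) ≤ h q - h ((q + p) / 2) := by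
      have h1 := mul_sub_le_binExp_clippedSlope_sub hs hw hDw hl
        (x := q - min ((q - p) / 2) (R / s)) (y := q)
        (by linarith [min_le_left ((q - p) / 2) (R / s)])
        (sub_le_self _ (le_min (by linarith) hRs.le)) hq1
        (by
          rw [sub_sub_cancel_left, mul_neg, ← hR, neg_le_neg_iff]
          calc s * min ((q - p) / 2) (R / s) ≤ s * (R / s) := by gcongr; exact min_le_right _ _
            _ = R := hsR)
        (by rw [sub_self, mul_zero]; linarith)
      rw [sub_sub_cancel] at h1
      have h2 : h ((q + p) / 2) ≤ h (q - min ((q - p) / 2) (R / s)) := by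
        have h3 := min_le_left ((q - p) / 2) (R / s)
        have h4 : 0 ≤ min ((q - p) / 2) (R / s) := le_min (by linarith) hRs.le
        refine hmono ⟨hm0, by linarith⟩ ⟨by linarith, by linarith⟩ (by linarith)
      linarith
    have hA : H q - H ((q + p) / 2) ≤ 0 * (q - (q + p) / 2) := by
      refine (convex_Icc 0 q).image_sub_le_mul_sub_of_deriv_le (hcont _) (hdiff _)
        (fun z hz => ?_) _ ⟨hm0, by linarith⟩ q ⟨hq0, le_rfl⟩ (by linarith)
      rw [interior_Icc] at hz
      rw [(hd z).deriv]
      exact mul_nonpos_of_nonneg_of_nonpos hs0.le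
        (sub_nonpos.mpr (hmono ⟨hz.1.le, hz.2.le.trans hq1⟩ ⟨hq0, hq1⟩ hz.2.le))
    have hB : H ((q + p) / 2) - H p ≤ s * (h ((q + p) / 2) - h q) * ((q + p) / 2 - p) := by
      refine (convex_Icc 0 ((q + p) / 2)).image_sub_le_mul_sub_of_deriv_le (hcont _) (hdiff _)
        (fun z hz => ?_) p ⟨hp0, by linarith⟩ _ ⟨hm0, le_rfl⟩ (by linarith)
      rw [interior_Icc] at hz
      rw [(hd z).deriv]
      gcongr
      exact hmono ⟨hz.1.le, by linarith [hz.2]⟩ ⟨hm0, by linarith⟩ hz.2.le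
    have hC : s * (s / (4 * w) * min ((q - p) / 2) (R / s)) * ((q - p) / 2) ≤
        s * (h q - h ((q + p) / 2)) * ((q + p) / 2 - p) := by
      rw [show (q + p) / 2 - p = (q - p) / 2 by ring]
      have : 0 ≤ (q - p) / 2 := by linarith
      gcongr
    have := hfin (q - p) (by linarith)
    rw [← abs_neg, show -(s * (p - q)) = s * (q - p) by ring,
      abs_of_nonneg (mul_nonneg hs0.le (sub_nonneg.mpr hpq))]
    linarith

theorem abs_binExp_clippedSlope_sub_le (hw : 0 < w) (hp0 : 0 ≤ p) (hp1 : p ≤ 1) (hq0 : 0 ≤ q)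
    (hq1 : q ≤ 1) (s : ℕ) (l : ℝ) :
    |binExp p (s - 1) (clippedSlope D w l) - binExp q (s - 1) (clippedSlope D w l)| ≤
      |s * (p - q)| / w := by
  have hd := hasDerivAt_binExp (s - 1) (clippedSlope D w l)
  have := (convex_Icc (0 : ℝ) 1).norm_image_sub_le_of_norm_hasDerivWithin_le
    (f := fun x => binExp x (s - 1) (clippedSlope D w l)) (C := s / w)
    (fun x _ => (hd x).hasDerivWithinAt) (fun x hx => ?_) ⟨hq0, hq1⟩ ⟨hp0, hp1⟩
  · rw [Real.norm_eq_abs, Real.norm_eq_abs] at this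
    refine this.trans_eq ?_
    rw [abs_mul, Nat.abs_cast]
    ring
  · have h1 := binExp_mono hx.1 hx.2 (s - 1 - 1)
      (clippedSlope_succ_sub_le (D := D) (l := l) hw)
    have h2 := binExp_mono hx.1 hx.2 (s - 1 - 1) (φ := fun _ => 0)
      fun k => sub_nonneg.mpr (clippedSlope_mono (D := D) (l := l) hw k)
    rw [binExp_const] at h1 h2
    rw [Real.norm_eq_abs, abs_of_nonneg (mul_nonneg (Nat.cast_nonneg _) h2),
      show (s : ℝ) / w = s * (1 / w) by ring]
    gcongr
    exact Nat.sub_le _ _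

theorem abs_binExp_clippedSlope_le (hD : 0 ≤ D) (hp0 : 0 ≤ p) (hp1 : p ≤ 1) (s : ℕ) :
    |binExp p s (clippedSlope D w l)| ≤ D := by
  have h := fun k => abs_le.mp (abs_clippedSlope_le (w := w) (l := l) hD k)
  have h1 := binExp_mono hp0 hp1 s (φ := fun _ => -D) fun k => (h k).1
  have h2 := binExp_mono hp0 hp1 s (ψ := fun _ => D) fun k => (h k).2
  rw [binExp_const] at h1 h2
  exact abs_le.mpr ⟨h1, h2⟩

/-- Here `μ` is an expected count, and `V` and `e` are the variance and the mean of the centred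
slope. For `r = d/w ≤ D`, `μ V ≤ (1+r)²` and `μ e² ≤ 4(1+r) r² w`, where `D w ≥ 10` absorbs the
stray `r²`. For `d ≥ D w` the clipping bounds suffice, since `w ≤ d/D`. -/
theorem mul_variance_add_sq_le {μ w D V d e : ℝ} (hw : 0 < w) (hDw : 10 ≤ D * w) (hμ : 0 ≤ μ)
    (hd : 0 ≤ d) (hμd : μ ≤ w + d) (hV1 : V ≤ D ^ 2) (hV2 : V ≤ μ / w ^ 2)
    (he : |e| ≤ 2 * min (d / w) D) :
    μ * (V + e ^ 2) ≤ 3 + 7 * (1 + D) * (d * min (d / w) D) := by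
  have hD : 0 < D := (mul_pos_iff_of_pos_right hw).mp (by linarith)
  have he2 : e ^ 2 ≤ (2 * min (d / w) D) ^ 2 := by
    rw [← sq_abs]
    exact pow_le_pow_left₀ (abs_nonneg _) he 2
  rcases le_total d (D * w) with h | h
  · have hle : d / w ≤ D := (div_le_iff₀ hw).mpr h
    rw [min_eq_left hle] at he2 ⊢
    set r := d / w with hr
    have hdr : d = r * w := by rw [hr]; field_simp
    have hr0 : 0 ≤ r := by positivity
    set ν := μ / w with hν
    have hμν : μ = ν * w := by rw [hν]; field_simp
    have hν1 : ν ≤ 1 + r := by rw [hν, div_le_iff₀ hw]; linarith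
    have hν0 : 0 ≤ ν := by positivity
    have h1 : μ * V ≤ ν ^ 2 := by
      calc μ * V ≤ μ * (μ / w ^ 2) := by gcongr
        _ = ν ^ 2 := by rw [hν]; ring
    have h2 : ν ^ 2 ≤ 2 + 2 * r ^ 2 := by nlinarith [sq_nonneg (r - 1)]
    have h3 : μ * e ^ 2 ≤ (1 + r) * w * (2 * r) ^ 2 := by
      rw [hμν]; gcongr
    have h4 : r ^ 2 * 10 ≤ r ^ 2 * (D * w) := by gcongr
    have h5 : r * (r ^ 2 * w) ≤ D * (r ^ 2 * w) := by gcongr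
    have h6 : 0 ≤ r ^ 2 * w := by positivity
    rw [hdr]
    nlinarith
  · have hle : D ≤ d / w := (le_div_iff₀ hw).mpr h
    rw [min_eq_right hle] at he2 ⊢
    have h1 : μ * (V + e ^ 2) ≤ (w + d) * (D ^ 2 + (2 * D) ^ 2) :=
      (mul_le_mul_of_nonneg_left (add_le_add hV1 he2) hμ).trans
        (mul_le_mul_of_nonneg_right hμd (by positivity))
    have h2 : D * (D * w) ≤ D * d := by gcongr
    have h3 : 0 ≤ D * d := by positivity
    have h4 : 0 ≤ D ^ 2 * d := by positivity
    nlinarith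

/-- The contribution of one point of the domain to the variance of the statistic. -/
theorem mul_binExp_huber_sq_le (hw : 0 < w) (hDw : 10 ≤ D * w) (hq0 : 0 ≤ q) (hq1 : q ≤ 1)
    (hp0 : 0 ≤ p) (hp1 : p ≤ 1) (hlw : s * q ≤ w) :
    s * (p * binExp p (s - 1) fun k => (huber D w q s (k + 1) - huber D w q s k) ^ 2) ≤
      3 + 7 * (1 + D) * (|s * (p - q)| * min (|s * (p - q)| / w) D) := by
  have hD : 0 < D := (mul_pos_iff_of_pos_right hw).mp (by linarith)
  simp only [huber_succ_sub]
  rw [binExp_sq_sub_const, ← mul_assoc]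
  set ψ := clippedSlope D w (s * q)
  have hmin : ∀ c : ℝ, binExp p (s - 1) (fun k => (ψ k - binExp p (s - 1) ψ) ^ 2) ≤
      binExp p (s - 1) (fun k => (ψ k - c) ^ 2) := fun c => by
    rw [binExp_sq_sub_const (s - 1) ψ c]
    exact le_add_of_nonneg_right (sq_nonneg _)
  refine mul_variance_add_sq_le hw hDw (by positivity) (abs_nonneg _) ?_ ?_ ?_ ?_
  · linarith [le_abs_self (s * (p - q))]
  · refine (hmin 0).trans ?_
    rw [← binExp_const (x := p) (s - 1) (D ^ 2)]
    refine binExp_mono hp0 hp1 _ fun k => ?_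
    rw [sub_zero, ← sq_abs]
    exact pow_le_pow_left₀ (abs_nonneg _) (abs_clippedSlope_le hD.le k) 2
  -- Clipping is 1-Lipschitz, so centring at the clipped slope of the mean count bounds the variance
  -- of the slope by that of the count over `w²`.
  · refine (hmin (max (-D) (min D ((((s - 1 : ℕ) : ℝ) * p - s * q) / w)))).trans ?_
    have h1 := binExp_mono hp0 hp1 (s - 1)
      (φ := fun k => (ψ k - max (-D) (min D ((((s - 1 : ℕ) : ℝ) * p - s * q) / w))) ^ 2)
      (ψ := fun k => 1 / w ^ 2 * ((k : ℝ) - ((s - 1 : ℕ) : ℝ) * p) ^ 2) fun k => by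
        rw [← sq_abs]
        refine (pow_le_pow_left₀ (abs_nonneg _) (abs_clip_sub_le D _ _) 2).trans_eq ?_
        rw [sq_abs]
        field_simp
        ring
    refine h1.trans ?_
    rw [binExp_const_mul, binExp_natCast_sub_sq, sub_self, mul_comm (1 / w ^ 2),
      mul_one_div]
    refine div_le_div_of_nonneg_right ?_ (by positivity)
    have h2 : (((s - 1 : ℕ) : ℝ)) ≤ s := by exact_mod_cast Nat.sub_le _ _
    have h3 : ((s - 1 : ℕ) : ℝ) * p ≤ s * p := by gcongr
    have h4 : 0 ≤ ((s - 1 : ℕ) : ℝ) * p := by positivity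
    nlinarith
  · rw [mul_min_of_nonneg _ _ (by norm_num : (0 : ℝ) ≤ 2)]
    refine le_min ((abs_binExp_clippedSlope_sub_le hw hp0 hp1 hq0 hq1 s _).trans ?_) ?_
    · have : 0 ≤ |s * (p - q)| / w := by positivity
      linarith
    · have h1 := abs_binExp_clippedSlope_le (w := w) (l := s * q) hD.le hp0 hp1 (s - 1)
      have h2 := abs_binExp_clippedSlope_le (w := w) (l := s * q) hD.le hq0 hq1 (s - 1)
      rw [abs_le] at h1 h2 ⊢
      constructor <;> linarith

end clipped

/-! ### The private identity tester and its sample size. -/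

section base

/-- The bound on the slopes of the summands of the statistic. -/
noncomputable def slopeBound (n s : ℕ) : ℝ := 10 * max ((n : ℝ) / s) √((n : ℝ) / s)

/-- The threshold gap of the statistic between `q` and the distributions far from it. -/
noncomputable def statisticGap (n s : ℕ) (ε : ℝ) : ℝ := s * ε * min (ε / 2) (slopeBound n s)

/-- The summands of the statistic. -/
noncomputable def huberSummand {n : ℕ} (q : PMF (Fin n)) (s : ℕ) (i : Fin n) (k : ℕ) : ℝ :=
  huber (slopeBound n s) (s * (q i).toReal + s / n) (q i).toReal s k

/-- A measure of the distance between `p` and `q` that bounds the shift of the mean of the statistic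
from below and the excess of its variance from above. -/
noncomputable def discrepancy {n : ℕ} (p q : PMF (Fin n)) (s : ℕ) : ℝ :=
  ∑ i, |s * ((p i).toReal - (q i).toReal)| *
    min (|s * ((p i).toReal - (q i).toReal)| / (s * (q i).toReal + s / n)) (slopeBound n s)

variable {n s : ℕ}

theorem pos_of_pmf (q : PMF (Fin n)) : 0 < n := by
  rcases n with _ | n
  · simpa using sum_toReal_eq_one q
  · exact n.succ_pos

theorem toReal_le_one (p : PMF (Fin n)) (i : Fin n) : (p i).toReal ≤ 1 := by
  simpa [mass] using mass_le_one p {i}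

theorem slopeBound_pos (hn : 0 < n) (hs : 0 < s) : 0 < slopeBound n s := by
  have : 0 < (n : ℝ) / s := by positivity
  exact mul_pos (by norm_num) (lt_max_of_lt_left this)

/-- This is what the `n/s` in `slopeBound` is for: the unclipped window is wider than a single
count. -/
theorem ten_le_slopeBound_mul (hn : 0 < n) (hs : 0 < s) {a : ℝ} (ha : 0 ≤ a) :
    10 ≤ slopeBound n s * (s * a + s / n) := by
  have h1 : 10 * ((n : ℝ) / s) ≤ slopeBound n s :=
    mul_le_mul_of_nonneg_left (le_max_left _ _) (by norm_num)
  calc (10 : ℝ) = 10 * ((n : ℝ) / s) * (0 + s / n) := by field_simp; norm_num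
    _ ≤ _ := by
        gcongr
        · exact (slopeBound_pos hn hs).le
        · positivity

theorem le_sq_slopeBound (n s : ℕ) : 100 * ((n : ℝ) / s) ≤ slopeBound n s ^ 2 := by
  have h1 : 10 * √((n : ℝ) / s) ≤ slopeBound n s :=
    mul_le_mul_of_nonneg_left (le_max_right _ _) (by norm_num)
  calc 100 * ((n : ℝ) / s) = (10 * √((n : ℝ) / s)) ^ 2 := by
        rw [mul_pow, Real.sq_sqrt (by positivity)]; norm_num
    _ ≤ _ := pow_le_pow_left₀ (by positivity) h1 2

theorem slopeBound_le {X : ℝ} (hX : 0 ≤ X) (h1 : 10 * ((n : ℝ) / s) ≤ X)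
    (h2 : 100 * ((n : ℝ) / s) ≤ X ^ 2) : slopeBound n s ≤ X := by
  rw [slopeBound, mul_max_of_nonneg _ _ (by norm_num : (0 : ℝ) ≤ 10)]
  refine max_le h1 ?_
  have : √((n : ℝ) / s) ≤ X / 10 := Real.sqrt_le_iff.mpr ⟨by positivity, by linarith⟩
  linarith

/-- This is what the `√(n/s)` in `slopeBound` is for: by AM-GM, `w² ≥ 4 (s a)(s/n)`, so the window
covers 20 times `√(s a)`. -/
theorem mul_le_sq_slopeBound_mul (hn : 0 < n) (hs : 0 < s) {a : ℝ} (ha : 0 ≤ a) :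
    400 * (s * a) ≤ (slopeBound n s * (s * a + s / n)) ^ 2 := by
  rw [mul_pow]
  calc 400 * (s * a) = 100 * ((n : ℝ) / s) * (4 * (s * a) * (s / n)) := by field_simp; ring
    _ ≤ slopeBound n s ^ 2 * (s * a + s / n) ^ 2 := by
        gcongr
        · exact le_sq_slopeBound n s
        · nlinarith [sq_nonneg ((s : ℝ) * a - s / n)]

theorem abs_huberSummand_succ_sub (q : PMF (Fin n)) (hs : 0 < s) (i : Fin n) (k : ℕ) :
    |huberSummand q s i (k + 1) - huberSummand q s i k| ≤ 2 * slopeBound n s := by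
  have hD := (slopeBound_pos (pos_of_pmf q) hs).le
  rw [huberSummand, huberSummand, huber_succ_sub]
  have h1 := abs_clippedSlope_le (w := s * (q i).toReal + s / n) (l := s * (q i).toReal) hD k
  have h2 := abs_binExp_clippedSlope_le (w := s * (q i).toReal + s / n) (l := s * (q i).toReal) hD
    ENNReal.toReal_nonneg (toReal_le_one q i) (s - 1)
  rw [abs_le] at h1 h2 ⊢
  constructor <;> linarith

theorem sum_binExp_huberSummand_ge (p q : PMF (Fin n)) (hs : 2 ≤ s) :
    ∑ i, binExp (q i).toReal s (huberSummand q s i) + discrepancy p q s / 80 ≤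
      ∑ i, binExp (p i).toReal s (huberSummand q s i) := by
  have hn := pos_of_pmf q
  have hs0 : 0 < s := by omega
  rw [discrepancy, div_eq_inv_mul, Finset.mul_sum, ← Finset.sum_add_distrib]
  refine Finset.sum_le_sum fun i _ => ?_
  have h0 : 0 ≤ (q i).toReal := ENNReal.toReal_nonneg
  have := binExp_huber_sub_ge (D := slopeBound n s) (w := s * (q i).toReal + s / n) (p := (p i).toReal)
    hs (by positivity) (ten_le_slopeBound_mul hn hs0 h0) h0 (toReal_le_one q i)
    ENNReal.toReal_nonneg (toReal_le_one p i) (mul_le_sq_slopeBound_mul hn hs0 h0)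
  rw [one_div] at this
  exact le_sub_iff_add_le'.mp this

theorem mul_sum_binExp_huberSummand_sq_le (p q : PMF (Fin n)) (hs : 0 < s) :
    s * ∑ i, (p i).toReal * binExp (p i).toReal (s - 1)
      (fun k => (huberSummand q s i (k + 1) - huberSummand q s i k) ^ 2) ≤
      3 * n + 7 * (1 + slopeBound n s) * discrepancy p q s := by
  have hn := pos_of_pmf q
  have : (3 * n : ℝ) = ∑ _i : Fin n, (3 : ℝ) := by simp [mul_comm]
  rw [discrepancy, this, Finset.mul_sum, Finset.mul_sum, ← Finset.sum_add_distrib]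
  refine Finset.sum_le_sum fun i _ => ?_
  have h0 : 0 ≤ (q i).toReal := ENNReal.toReal_nonneg
  exact mul_binExp_huber_sq_le (by positivity) (ten_le_slopeBound_mul hn hs h0) h0
    (toReal_le_one q i) ENNReal.toReal_nonneg (toReal_le_one p i)
    (le_add_of_nonneg_right (by positivity))

theorem discrepancy_self (q : PMF (Fin n)) (s : ℕ) : discrepancy q q s = 0 := by
  simp [discrepancy]

/-- For `0 ≤ t ≤ D`, `d min(d/w, D) ≥ t d - t² w`. As the `w_i` sum to `2s`, summation gives at
least `2 t s ε - 2 t² s`, and `t = min(ε/2, D)` leaves `t s ε`. -/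
theorem statisticGap_le_discrepancy {p q : PMF (Fin n)} {ε : ℝ} (hs : 0 < s) (hε : 0 < ε)
    (h : ε < tv p q) : statisticGap n s ε ≤ discrepancy p q s := by
  have hn := pos_of_pmf q
  set t := min (ε / 2) (slopeBound n s) with ht
  have ht0 : 0 < t := lt_min (by linarith) (slopeBound_pos hn hs)
  have hs' : (0 : ℝ) < s := by exact_mod_cast hs
  have hterm : ∀ i, t * (s * |(p i).toReal - (q i).toReal|) -
      t ^ 2 * (s * (q i).toReal + s / n) ≤ |s * ((p i).toReal - (q i).toReal)| *
      min (|s * ((p i).toReal - (q i).toReal)| / (s * (q i).toReal + s / n))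
        (slopeBound n s) := by
    intro i
    have h0 : 0 ≤ (q i).toReal := ENNReal.toReal_nonneg
    have hw : 0 < s * (q i).toReal + s / n := by positivity
    rw [abs_mul, abs_of_pos hs']
    set d := s * |(p i).toReal - (q i).toReal|
    set w := s * (q i).toReal + s / n
    have hd : 0 ≤ d := by positivity
    rw [mul_min_of_nonneg _ _ hd]
    refine le_min ?_ ?_
    · rw [← mul_div_assoc, le_div_iff₀ hw]
      nlinarith [sq_nonneg (d - t * w), mul_nonneg (mul_nonneg ht0.le hd) hw.le]
    · have h1 : t * d ≤ slopeBound n s * d := by gcongr; exact min_le_right _ _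
      have h2 : 0 ≤ t ^ 2 * w := by positivity
      linarith
  have hsum := Finset.sum_le_sum fun i (_ : i ∈ Finset.univ) => hterm i
  rw [Finset.sum_sub_distrib, ← Finset.mul_sum, ← Finset.mul_sum, ← Finset.mul_sum,
    Finset.sum_add_distrib, ← Finset.mul_sum, sum_toReal_eq_one, Finset.sum_const,
    Finset.card_univ, Fintype.card_fin, nsmul_eq_mul, mul_div_cancel₀ _ (by positivity)] at hsum
  have h1 : 2 * ε ≤ ∑ i, |(p i).toReal - (q i).toReal| := by linarith [two_mul_tv_le p q]
  have h2 : t * (s * (2 * ε)) ≤ t * (s * ∑ i, |(p i).toReal - (q i).toReal|) := by gcongr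
  have h3 : t ^ 2 * s ≤ t * s * (ε / 2) := by
    have : t ≤ ε / 2 := min_le_left _ _
    have : t * s * t ≤ t * s * (ε / 2) := by gcongr
    linarith
  calc statisticGap n s ε = t * (s * (2 * ε)) - 2 * (t * s * (ε / 2)) := by
        rw [statisticGap]; ring
    _ ≤ t * (s * ∑ i, |(p i).toReal - (q i).toReal|) - t ^ 2 * (s * 1 + s) := by linarith
    _ ≤ _ := hsum

open Classical in
/-- The answer of the identity tester at the noisy statistic `y`. -/
noncomputable def thresholdAnswer (c y : ℝ) : Answer :=
  if y ≤ c then Answer.accept else Answer.reject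

theorem measurable_thresholdAnswer (c : ℝ) : Measurable (thresholdAnswer c) :=
  Measurable.ite (measurableSet_le measurable_id measurable_const) measurable_const
    measurable_const

/-- The private identity tester: compare a noisy Lipschitz variant of the `χ²` statistic with a
threshold. -/
noncomputable def identityTester (s : ℕ) (q : PMF (Fin n)) (ε ξ : ℝ) : SampleAlgorithm n :=
  SampleAlgorithm.noisyAdditive s (huberSummand q s) (4 * slopeBound n s / ξ)
    (thresholdAnswer
      (∑ i, binExp (q i).toReal s (huberSummand q s i) + statisticGap n s ε / 160))

theorem isPrivateTester_identityTester (q : PMF (Fin n)) {ε ξ : ℝ} (hs : 2 ≤ s) (hε : 0 < ε)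
    (hξ : 0 < ξ) (h1 : 10 ^ 8 * (n : ℝ) ≤ statisticGap n s ε ^ 2)
    (h2 : 10 ^ 8 * (1 + slopeBound n s) ≤ statisticGap n s ε)
    (h3 : 10 ^ 8 * (slopeBound n s / ξ) ≤ statisticGap n s ε) :
    (identityTester s q ε ξ).IsPrivateTester ξ ε (1 / 10) {q} := by
  have hs0 : 0 < s := by omega
  have hD : 0 < slopeBound n s := slopeBound_pos (pos_of_pmf q) hs0
  have hG : 0 < statisticGap n s ε := by linarith
  have hb : 0 < 4 * slopeBound n s / ξ := by positivity
  have ht : 10 * (4 * slopeBound n s / ξ) ≤ statisticGap n s ε / 320 := by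
    have : 0 ≤ slopeBound n s / ξ := by positivity
    rw [mul_div_assoc]
    linarith
  unfold identityTester
  set E := ∑ i, binExp (q i).toReal s (huberSummand q s i) with hE
  have hg := measurable_thresholdAnswer (E + statisticGap n s ε / 160)
  refine ⟨SampleAlgorithm.isRandomized_noisyAdditive hb hg,
    SampleAlgorithm.isDP_noisyAdditive hb hg (l := -(2 * slopeBound n s))
      (u := 2 * slopeBound n s) (fun i k => abs_le.mp (abs_huberSummand_succ_sub q hs0 i k)) ?_,
    fun x => ?_, ?_, ?_⟩
  · rw [div_mul_cancel₀ _ hξ.ne']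
    linarith
  · refine (SampleAlgorithm.run_noisyAdditive hg x _).trans ?_
    convert measure_empty (μ := laplace (4 * slopeBound n s / ξ))
    ext z
    simp only [thresholdAnswer, Set.mem_preimage, Set.mem_singleton_iff, Set.mem_empty_iff_false,
      iff_false]
    split_ifs <;> simp
  · rintro p rfl
    refine SampleAlgorithm.prob_noisyAdditive_le hb hg p (a := statisticGap n s ε / 320)
      (by positivity) ht (mul_sum_binExp_huberSummand_sq_le p p hs0) ?_ ?_
    · rw [discrepancy_self, div_pow]
      linarith
    · intro y z hyz hy
      simp only [thresholdAnswer, Set.mem_singleton_iff, ite_eq_right_iff, reduceCtorEq, imp_false,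
        not_le] at hyz
      linarith [(abs_lt.mp hy).2, le_abs_self z]
  · intro p hp
    have hΓ := statisticGap_le_discrepancy hs0 hε (hp q rfl)
    set Γ := discrepancy p q s
    -- The allowed deviation scales with `Γ`, not with the gap, because the variance grows with `Γ`
    -- as well.
    refine SampleAlgorithm.prob_noisyAdditive_le hb hg p (a := Γ / 320)
      (div_pos (hG.trans_le hΓ) (by norm_num)) ht
      (mul_sum_binExp_huberSummand_sq_le p q hs0) ?_ ?_
    · have h4 : 10 ^ 8 * (1 + slopeBound n s) * Γ ≤ Γ * Γ :=
        mul_le_mul_of_nonneg_right (h2.trans hΓ) (hG.le.trans hΓ)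
      have h5 : statisticGap n s ε ^ 2 ≤ Γ ^ 2 := pow_le_pow_left₀ hG.le hΓ 2
      rw [div_pow]
      change 20 * (3 * (n : ℝ) + 7 * (1 + slopeBound n s) * Γ) ≤ _
      have h6 : 0 ≤ (1 + slopeBound n s) * Γ := by
        have := hG.le.trans hΓ
        positivity
      nlinarith
    · intro y z hyz hy
      simp only [thresholdAnswer, Set.mem_singleton_iff, ite_eq_left_iff, reduceCtorEq, imp_false,
        not_not] at hyz
      have := sum_binExp_huberSummand_ge p q hs
      linarith [(abs_lt.mp hy).1, neg_le_abs z]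

theorem one_le_identityRate (hn : 0 < n) {ε ξ : ℝ} (hε : 0 < ε) (hε1 : ε ≤ 1) (hξ : 0 < ξ) :
    1 ≤ identityRate n ε ξ := by
  have h1 : 1 ≤ √(n : ℝ) / ε ^ 2 := by
    rw [one_le_div (by positivity)]
    exact (pow_le_one₀ hε.le hε1).trans (Real.one_le_sqrt.mpr (by exact_mod_cast hn))
  have h2 : 0 ≤ √(n : ℝ) / (ε * √ξ) := by positivity
  have h3 : 0 ≤ (n : ℝ) ^ (1 / 3 : ℝ) / (ε ^ (4 / 3 : ℝ) * ξ ^ (2 / 3 : ℝ)) := by positivity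
  have h4 : 0 ≤ 1 / (ε * ξ) := by positivity
  unfold identityRate
  linarith

/-- What a sample size of the order of the rate means for the four regimes. -/
theorem regimes_of_identityRate_le {K ε ξ S : ℝ} (hK : 0 ≤ K) (hε : 0 < ε)
    (hξ : 0 < ξ) (h : K * identityRate n ε ξ ≤ S) :
    K ^ 2 * n ≤ (S * ε ^ 2) ^ 2 ∧ K ^ 2 * n ≤ S ^ 2 * ε ^ 2 * ξ ∧
      K ^ 3 * n ≤ S ^ 3 * ε ^ 4 * ξ ^ 2 ∧ K ≤ S * ε * ξ := by
  have h1 : 0 ≤ √(n : ℝ) / ε ^ 2 := by positivity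
  have h2 : 0 ≤ √(n : ℝ) / (ε * √ξ) := by positivity
  have h3 : 0 ≤ (n : ℝ) ^ (1 / 3 : ℝ) / (ε ^ (4 / 3 : ℝ) * ξ ^ (2 / 3 : ℝ)) := by positivity
  have h4 : 0 ≤ 1 / (ε * ξ) := by positivity
  have key : ∀ r, r ≤ identityRate n ε ξ → K * r ≤ S := fun r hr =>
    (mul_le_mul_of_nonneg_left hr hK).trans h
  have hn : √(n : ℝ) ^ 2 = n := Real.sq_sqrt (Nat.cast_nonneg n)
  refine ⟨?_, ?_, ?_, ?_⟩
  · have := key (√(n : ℝ) / ε ^ 2) (by unfold identityRate; linarith)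
    rw [← mul_div_assoc, div_le_iff₀ (by positivity)] at this
    have := pow_le_pow_left₀ (by positivity) this 2
    rwa [mul_pow, hn] at this
  · have := key (√(n : ℝ) / (ε * √ξ)) (by unfold identityRate; linarith)
    rw [← mul_div_assoc, div_le_iff₀ (by positivity)] at this
    have := pow_le_pow_left₀ (by positivity) this 2
    rwa [mul_pow, hn, mul_pow, mul_pow, Real.sq_sqrt hξ.le, ← mul_assoc] at this
  · have := key _ (by unfold identityRate; linarith :
      (n : ℝ) ^ (1 / 3 : ℝ) / (ε ^ (4 / 3 : ℝ) * ξ ^ (2 / 3 : ℝ)) ≤ identityRate n ε ξ)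
    rw [← mul_div_assoc, div_le_iff₀ (by positivity)] at this
    have := pow_le_pow_left₀ (by positivity) this 3
    have e : ∀ {x : ℝ} (a : ℝ), 0 ≤ x → (x ^ a) ^ 3 = x ^ (a * 3) := fun a hx => by
      rw [← Real.rpow_natCast, ← Real.rpow_mul hx]; norm_num
    rw [mul_pow, mul_pow, mul_pow, e _ (Nat.cast_nonneg n), e _ hε.le, e _ hξ.le,
      ← mul_assoc] at this
    norm_num at this
    exact_mod_cast this
  · have := key (1 / (ε * ξ)) (by unfold identityRate; linarith)
    rw [mul_one_div, div_le_iff₀ (by positivity)] at this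
    linarith

/-- If `ε/2 ≤ D`, the gap is `sε²/2`. The first term of `f` handles `n` and `1 + D`; the second and
third make `n/s` and `√(n/s)`, the two parts of `D`, small against `sε²ξ`. Otherwise the gap is
`sεD`: `D² ≥ 100 n/s` and `sε² ≥ 10^15` handle `n` and the constant, `sε ≥ 10^15` handles `D`, and
the fourth term handles `D/ξ`. -/
theorem statisticGap_bounds {ε ξ : ℝ} (hn : 0 < n) (hs : 0 < s) (hε : 0 < ε) (hε1 : ε ≤ 1)
    (hξ : 0 < ξ) (h : 10 ^ 15 * identityRate n ε ξ ≤ s) :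
    10 ^ 8 * (n : ℝ) ≤ statisticGap n s ε ^ 2 ∧
      10 ^ 8 * (1 + slopeBound n s) ≤ statisticGap n s ε ∧
      10 ^ 8 * (slopeBound n s / ξ) ≤ statisticGap n s ε := by
  obtain ⟨f1, f2, f3, f4⟩ := regimes_of_identityRate_le (by norm_num) hε hξ h
  have hs' : (1 : ℝ) ≤ s := by exact_mod_cast hs
  have hn' : (1 : ℝ) ≤ n := by exact_mod_cast hn
  have hD := slopeBound_pos hn hs
  have hDsq := le_sq_slopeBound n s
  rw [← mul_div_assoc, div_le_iff₀ (by linarith)] at hDsq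
  set D := slopeBound n s with hDdef
  have hu : 10 ^ 15 ≤ s * ε ^ 2 := by
    have : (10 ^ 15 : ℝ) ^ 2 ≤ (s * ε ^ 2) ^ 2 := by linarith
    exact (pow_le_pow_iff_left₀ (by norm_num) (by positivity) (by norm_num)).mp this
  have hv : 10 ^ 15 ≤ s * ε := hu.trans (by gcongr; nlinarith)
  unfold statisticGap
  rcases le_total (ε / 2) D with hc | hc
  · rw [min_eq_left hc]
    have e : s * ε * (ε / 2) = s * ε ^ 2 / 2 := by ring
    rw [e]
    refine ⟨by rw [div_pow]; linarith, ?_, ?_⟩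
    · have : D ≤ s * ε ^ 2 / (4 * 10 ^ 8) := by
        refine slopeBound_le (by positivity) ?_ ?_
        · rw [← mul_div_assoc, div_le_iff₀ (by linarith)]
          have : (s * ε ^ 2) ^ 2 ≤ s * ε ^ 2 * s := by
            rw [sq]; gcongr; nlinarith [pow_le_one₀ hε.le hε1 (n := 2)]
          linarith
        · rw [← mul_div_assoc, div_le_iff₀ (by linarith), div_pow]
          have : (s * ε ^ 2) ^ 2 * 1 ≤ (s * ε ^ 2) ^ 2 * s := by gcongr
          linarith
      linarith
    · have : D ≤ s * ε ^ 2 / (2 * 10 ^ 8) * ξ := by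
        refine slopeBound_le (by positivity) ?_ ?_
        · rw [← mul_div_assoc, div_le_iff₀ (by linarith)]
          have : s * ε ^ 2 / (2 * 10 ^ 8) * ξ * s = s ^ 2 * ε ^ 2 * ξ / (2 * 10 ^ 8) := by ring
          linarith
        · rw [← mul_div_assoc, div_le_iff₀ (by linarith)]
          have : (s * ε ^ 2 / (2 * 10 ^ 8) * ξ) ^ 2 * s =
            s ^ 3 * ε ^ 4 * ξ ^ 2 / (2 * 10 ^ 8) ^ 2 := by ring
          linarith
      have h2 : D / ξ ≤ s * ε ^ 2 / (2 * 10 ^ 8) := (div_le_iff₀ hξ).mpr this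
      linarith
  · rw [min_eq_right hc]
    have hA : 100 * (s * ε ^ 2) * n ≤ (s * ε * D) ^ 2 := by
      calc 100 * (s * ε ^ 2) * n = s * ε ^ 2 * (100 * n) := by ring
        _ ≤ s * ε ^ 2 * (D ^ 2 * s) := by gcongr
        _ = _ := by ring
    have hB : (2 * 10 ^ 8 : ℝ) ≤ s * ε * D := by
      have : (2 * 10 ^ 8 : ℝ) ^ 2 ≤ (s * ε * D) ^ 2 := by
        refine le_trans ?_ hA
        nlinarith
      exact (pow_le_pow_iff_left₀ (by norm_num) (by positivity) (by norm_num)).mp this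
    refine ⟨le_trans (by gcongr; linarith) hA, ?_, ?_⟩
    · have : 10 ^ 15 * D ≤ s * ε * D := by gcongr
      linarith
    · rw [mul_div, div_le_iff₀ hξ]
      have : 10 ^ 15 * D ≤ s * ε * ξ * D := by gcongr
      linarith

end base

end PrivTest

/-! ### Assembling the two testers. -/

theorem mainTheorem1 :
    ∃ (base : (n : ℕ) → PMF (Fin n) → ℝ → ℝ → PrivTest.SampleAlgorithm n) (K c C : ℝ),
      0 < K ∧ 0 < c ∧ 0 < C ∧
      -- the subroutine: a private identity tester without advice
      (∀ (n : ℕ) (q : PMF (Fin n)) (ε ξ : ℝ), 0 < ε → ε ≤ 1 → 0 < ξ →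
        (base n q ε ξ).IsPrivateTester ξ ε (1 / 10) {q} ∧
        PrivTest.IsThetaWith c C (base n q ε ξ).numSamples (PrivTest.identityRate n ε ξ)) ∧
      -- the augmented tester
      (∀ (n : ℕ) (q phat : PMF (Fin n)) (ε α ξ : ℝ),
        0 < ε → ε ≤ 1 → 0 ≤ α → α < 1 → 0 < ξ →
        (PrivTest.augmentedIdentityTester base K q phat ε α ξ).IsPrivateAugmentedTester
          ξ ε α (1 / 10) phat {q} ∧
        (PrivTest.tv phat q ≤ α →
          PrivTest.IsThetaWith c C
            (PrivTest.augmentedIdentityTester base K q phat ε α ξ).numSamples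
            (PrivTest.identityRate n ε ξ)) ∧
        (α < PrivTest.tv phat q →
          PrivTest.IsThetaWith c C
            (PrivTest.augmentedIdentityTester base K q phat ε α ξ).numSamples
            (min (PrivTest.scheffeRate (PrivTest.tv phat q - α) ξ)
              (PrivTest.identityRate n ε ξ)) ∧
          -- the noisy Scheffé test attains the first term of the minimum
          (PrivTest.scheffeTester K q phat α ξ).IsPrivateAugmentedTester
            ξ ε α (1 / 10) phat {q} ∧
          PrivTest.IsThetaWith c C (PrivTest.scheffeTester K q phat α ξ).numSamples
            (PrivTest.scheffeRate (PrivTest.tv phat q - α) ξ))) := by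
  let base : (n : ℕ) → PMF (Fin n) → ℝ → ℝ → PrivTest.SampleAlgorithm n := fun n q ε ξ =>
    PrivTest.identityTester ⌈(10 : ℝ) ^ 15 * PrivTest.identityRate n ε ξ⌉₊ q ε ξ
  have hbase : ∀ (n : ℕ) (q : PMF (Fin n)) (ε ξ : ℝ), 0 < ε → ε ≤ 1 → 0 < ξ →
      (base n q ε ξ).IsPrivateTester ξ ε (1 / 10) {q} ∧
      PrivTest.IsThetaWith 1 (10 ^ 15 + 1) (base n q ε ξ).numSamples
        (PrivTest.identityRate n ε ξ) := by
    intro n q ε ξ hε hε1 hξ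
    have hn := PrivTest.pos_of_pmf q
    have hr := PrivTest.one_le_identityRate hn hε hε1 hξ
    have hs : 2 ≤ ⌈(10 : ℝ) ^ 15 * PrivTest.identityRate n ε ξ⌉₊ := by
      have : (2 : ℝ) ≤ ⌈(10 : ℝ) ^ 15 * PrivTest.identityRate n ε ξ⌉₊ :=
        le_trans (by linarith) (Nat.le_ceil _)
      exact_mod_cast this
    obtain ⟨h1, h2, h3⟩ := PrivTest.statisticGap_bounds hn (by omega) hε hε1 hξ (Nat.le_ceil _)
    exact ⟨PrivTest.isPrivateTester_identityTester q hs hε hξ h1 h2 h3,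
      PrivTest.isThetaWith_ceil (by norm_num) le_rfl hr⟩
  refine ⟨base, 1280, 1, 10 ^ 15 + 1, by norm_num, by norm_num, by norm_num, hbase, ?_⟩
  intro n q phat ε α ξ hε hε1 hα _ hξ
  obtain ⟨hb, hbΘ⟩ := hbase n q ε ξ hε hε1 hξ
  -- A tester that never answers `bot` meets the advice requirement for every advice.
  have haug : (base n q ε ξ).IsPrivateAugmentedTester ξ ε α (1 / 10) phat {q} := by
    refine ⟨hb.randomized, hb.dp, hb.sound_mem, hb.sound_far, fun p _ => ?_⟩
    simp [PrivTest.SampleAlgorithm.prob, hb.not_bot]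
  have hsch : α < PrivTest.tv phat q →
      (PrivTest.scheffeTester 1280 q phat α ξ).IsPrivateAugmentedTester ξ ε α (1 / 10) phat {q} ∧
      PrivTest.IsThetaWith 1 (10 ^ 15 + 1) (PrivTest.scheffeTester 1280 q phat α ξ).numSamples
        (PrivTest.scheffeRate (PrivTest.tv phat q - α) ξ) := fun h =>
    ⟨PrivTest.isPrivateAugmentedTester_scheffeTester le_rfl q phat ε h hξ,
      PrivTest.isThetaWith_ceil (by norm_num) (by norm_num)
        (PrivTest.one_le_scheffeRate (sub_pos.mpr h)
          (by linarith [PrivTest.tv_le_one phat q]) hξ)⟩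
  unfold PrivTest.augmentedIdentityTester
  split_ifs with hcase
  · refine ⟨haug, fun _ => hbΘ, fun h => ⟨?_, hsch h⟩⟩
    rwa [min_eq_right (hcase.resolve_left (not_le.mpr h))]
  · obtain ⟨h1, h2⟩ := not_or.mp hcase
    refine ⟨(hsch (not_le.mp h1)).1, fun h => absurd h h1, fun h => ⟨?_, hsch h⟩⟩
    rw [min_eq_left (not_le.mp h2).le]
    exact (hsch h).2
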